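/- Setting. Let $Z\in\mathbb R^{d_z}$, $W\in\mathbb R^{d_w}$ and $U\in\mathbb R$ be random variables with $E[U\mid W]=0$. Let $W$ have Lebesgue density $p_W$ and support $\mathcal W$, let $\nu$ be a probability density on $\mathbb R^{d_w}$, and let $\{f_j\}_{j\ge1}$ be an orthonormal basis of $L^2_\nu=\{\phi:\int\phi^2(s)\nu(s)\,ds<\infty\}$. Let $\varphi_0$ be a known function. Assume: 1. there are constants $\eta_f,\eta_p\ge1$ with $\sup_{j\ge1}\int|f_j(s)|^4\nu(s)\,ds\le\eta_f$, and $\nu>0$ on $\mathcal W$ with $\sup_{w\in\mathcal W}p_W(w)/\nu(w)\le\eta_p$; 2. $E[U^4\mid W]\le\sigma^4$ almost surely for a constant $\sigma>0$; 3. the conditional expectation operator $T\phi=E[\phi(Z)\mid W]$, defined on $L^2_Z=\{\phi:E|\phi(Z)|^2<\infty\}$, is nonsingular (injective); 4. the weights $\tau=(\tau_j)_{j\ge1}$ are positive and nonincreasing with $\tau_1=1$. Put $s_{jl}=\sqrt{\tau_j\tau_l}\,E[U^2f_j(W)f_l(W)]$, $\mu_m=\sum_{j=1}^m s_{jj}$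 and $\varsigma_m=\big(\sum_{j,l=1}^m s_{jl}^2\big)^{1/2}$. Let $(m_n)$ be a sequence of integers with $$\varsigma_{m_n}^{-1}=o(1)\quad\text{and}\quad\Big(\sum_{j=1}^{m_n}\tau_j\Big)^3=o(n)\qquad(n\to\infty).$$ Local alternatives. Let $\delta$ satisfy $E|\delta(Z)|^4<\infty$, let $(Z_i,W_i,U_i)_{i\ge1}$ be i.i.d. copies of $(Z,W,U)$, and for each $n$ let the $n$-th sample be $(Y_i,Z_i,W_i)_{1\le i\le n}$ with $$Y_i=\varphi_0(Z_i)+\varsigma_{m_n}^{1/2}n^{-1/2}\,\delta(Z_i)+U_i .$$ Let $$S_n=\sum_{j=1}^{m_n}\tau_j\Big|\frac1n\sum_{i=1}^n\big(Y_i-\varphi_0(Z_i)\big)f_j(W_i)\Big|^2,\qquad \delta_j=\sqrt{\tau_j}\,E[\delta(Z)f_j(W)].$$ Proposition. Then $\sum_{j\ge1}\delta_j^2<\infty$ and $$(\sqrt2\,\varsigma_{m_n})^{-1}\big(nS_n-\mu_{m_n}\big)\ \xrightarrow{\ d\ }\ N\Big(2^{-1/2}\sum_{j=1}^\infty\delta_j^2,\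 1\Big).$$ -/

import Mathlib

open MeasureTheory ProbabilityTheory Filter Topology Asymptotics

/- Sequences that the mathematics indexes by `j = 1, 2, …` (basis functions, weights) are indexed
by `ℕ` here, `f j` and `τ j` standing for `f_{j+1}` and `τ_{j+1}`; a sum over `1 ≤ j ≤ m` is a sum
over `Finset.range m`.  Likewise the observations `1 ≤ i ≤ n` are `i ∈ Finset.range n`. -/

noncomputable section

namespace NPIV

/-- Values of a `k`-dimensional random vector. -/
abbrev Vec (k : ℕ) : Type := EuclideanSpace ℝ (Fin k)

/-- `p` is a probability density function with respect to Lebesgue measure on `ℝᵏ`. -/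
structure IsProbDensity {k : ℕ} (p : Vec k → ℝ) : Prop where
  measurable : Measurable p
  nonneg : ∀ s, 0 ≤ p s
  lintegral_eq_one : ∫⁻ s, ENNReal.ofReal (p s) = 1

/-- The measure `p(s) ds`. -/
def densMeasure {k : ℕ} (p : Vec k → ℝ) : Measure (Vec k) :=
  (volume : Measure (Vec k)).withDensity fun s => ENNReal.ofReal (p s)

/-- `f` is (a sequence of representatives of) an orthonormal basis of `L²(μ)`. -/
def IsOrthonormalBasisL2 {k : ℕ} (μ : Measure (Vec k)) (f : ℕ → Vec k → ℝ) : Prop :=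
  ∃ b : HilbertBasis ℕ ℝ (Lp ℝ 2 μ), ∀ j, (b j : Vec k → ℝ) =ᵐ[μ] f j

variable {Ω : Type*} [MeasurableSpace Ω]

/-- The `σ`-algebra on `Ω` generated by `W`. -/
abbrev sigmaOf {k : ℕ} (W : Ω → Vec k) : MeasurableSpace Ω :=
  MeasurableSpace.comap W inferInstance

/-- The support of (the law of) `W`. -/
def supp {k : ℕ} (P : Measure Ω) (W : Ω → Vec k) : Set (Vec k) := (P.map W).support

/-- Uniform bound on the fourth moments of the basis functions with respect to `ν`, and uniform
bound on the density ratio `p_W / ν` on the support of `W`, on which `ν` is strictly positive. -/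
def BasisAndDensityBounds {k : ℕ} (P : Measure Ω) (W : Ω → Vec k) (pW ν : Vec k → ℝ)
    (f : ℕ → Vec k → ℝ) : Prop :=
  ∃ ηf ηp : ℝ, 1 ≤ ηf ∧ 1 ≤ ηp ∧
    (∀ j, ∫⁻ s, ENNReal.ofReal (|f j s| ^ 4) ∂(densMeasure ν) ≤ ENNReal.ofReal ηf) ∧
    (∀ w ∈ supp P W, 0 < ν w ∧ pW w / ν w ≤ ηp)

/-- `E[U⁴ | W] ≤ σ⁴` for a constant `σ > 0`.  (The conditional expectation of `U⁴` is meaningful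
because `U` is required to have a fourth moment, which the bound itself entails.) -/
def CondFourthMomentBound {k : ℕ} (P : Measure Ω) (W : Ω → Vec k) (U : Ω → ℝ) : Prop :=
  MemLp U 4 P ∧ ∃ σ : ℝ, 0 < σ ∧
    ∀ᵐ ω ∂P, (P[fun ω => U ω ^ 4 | sigmaOf W]) ω ≤ σ ^ 4

/-- The (linear) conditional expectation operator `T φ = E[φ(Z) | W]` on `L²_Z` is nonsingular:
its kernel is trivial. -/
def CondExpNonsingular {k l : ℕ} (P : Measure Ω) (Z : Ω → Vec l) (W : Ω → Vec k) : Prop :=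
  ∀ φ : Vec l → ℝ, Measurable φ → MemLp (fun ω => φ (Z ω)) 2 P →
    P[fun ω => φ (Z ω) | sigmaOf W] =ᵐ[P] 0 → (fun ω => φ (Z ω)) =ᵐ[P] 0

/-- The weighting sequence is positive, nonincreasing, and its first term is `1`. -/
structure IsWeighting (τ : ℕ → ℝ) : Prop where
  pos : ∀ j, 0 < τ j
  antitone : Antitone τ
  first : τ 0 = 1

/-- `f_j^τ = √τ_j f_j`. -/
def fw {k : ℕ} (τ : ℕ → ℝ) (f : ℕ → Vec k → ℝ) (j : ℕ) (w : Vec k) : ℝ :=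
  Real.sqrt (τ j) * f j w

/-- `s_{jl} = E[U² f_j^τ(W) f_l^τ(W)]`. -/
def sEntry {k : ℕ} (P : Measure Ω) (U : Ω → ℝ) (W : Ω → Vec k) (τ : ℕ → ℝ)
    (f : ℕ → Vec k → ℝ) (j l : ℕ) : ℝ :=
  ∫ ω, U ω ^ 2 * fw τ f j (W ω) * fw τ f l (W ω) ∂P

/-- The trace `μ_m` of `Σ_m = (s_{jl})_{1 ≤ j, l ≤ m}`. -/
def traceSigma {k : ℕ} (P : Measure Ω) (U : Ω → ℝ) (W : Ω → Vec k) (τ : ℕ → ℝ)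
    (f : ℕ → Vec k → ℝ) (m : ℕ) : ℝ :=
  ∑ j ∈ Finset.range m, sEntry P U W τ f j j

/-- The Frobenius norm `ς_m` of `Σ_m = (s_{jl})_{1 ≤ j, l ≤ m}`. -/
def frobSigma {k : ℕ} (P : Measure Ω) (U : Ω → ℝ) (W : Ω → Vec k) (τ : ℕ → ℝ)
    (f : ℕ → Vec k → ℝ) (m : ℕ) : ℝ :=
  Real.sqrt (∑ j ∈ Finset.range m, ∑ l ∈ Finset.range m, sEntry P U W τ f j l ^ 2)

/-- The test statistic
`S_n = ∑_{j ≤ m} τ_j |n⁻¹ ∑_{i ≤ n} (Y_i - φ₀(Z_i)) f_j(W_i)|²`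
computed from the sample `(Y_i, Z_i, W_i)`, `i ≤ n`, with truncation `m`. -/
def testStat {k l : ℕ} (φ₀ : Vec l → ℝ) (τ : ℕ → ℝ) (f : ℕ → Vec k → ℝ) (m n : ℕ)
    (Y : ℕ → Ω → ℝ) (Z : ℕ → Ω → Vec l) (W : ℕ → Ω → Vec k) (ω : Ω) : ℝ :=
  ∑ j ∈ Finset.range m, τ j *
    |(n : ℝ)⁻¹ * ∑ i ∈ Finset.range n, (Y i ω - φ₀ (Z i ω)) * f j (W i ω)| ^ 2

/-- `δ_j = √τ_j E[δ(Z) f_j(W)]`. -/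
def deltaCoef {k l : ℕ} (P : Measure Ω) (Z : Ω → Vec l) (W : Ω → Vec k) (τ : ℕ → ℝ)
    (f : ℕ → Vec k → ℝ) (δ : Vec l → ℝ) (j : ℕ) : ℝ :=
  Real.sqrt (τ j) * ∫ ω, δ (Z ω) * f j (W ω) ∂P

end NPIV

end

open scoped RealInnerProductSpace

/-! ### Elementary inequalities, and Fubini for independent variables. -/

namespace NPIV

/-! Put X_i = (√τ_j U_i f_j(W_i))_j and G_i = (√τ_j δ(Z_i) f_j(W_i))_j, vectors in dimension m_n.
Then n S_n = ‖∑ (X_i + c G_i)‖² / n with c² = ς/n. The X_i are i.i.d., centred because E[U | W] = 0,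
and their covariance Σ = (s_jl) has trace μ and Hilbert–Schmidt norm ς. Expanding the square around
d = E G_i leaves the centring μ, the degenerate U-statistic (2/n) ∑_{j<i} ⟪X_i, X_j⟫, the drift c² n
‖d‖² = ς ∑_{j≤m_n} δ_j², and a remainder that is o(ς) in L¹. Division by √2 ς turns the drift into
the mean of the limit: a Bessel inequality makes ∑ δ_j² finite, and ς_{m_n} → ∞ forces m_n → ∞.

The dimension changes with n, so the central limit theorem needs dimension-free error bounds. It is
a martingale argument run on characteristic functions (`norm_charFun_step_le`,
`norm_charFun_offDiagSum_sub_le`). With S_k = ∑_{i<k} X_i, the increment ⟪X_k, S_k⟫ has, given the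
past, mean zero and variance ⟪Σ S_k, S_k⟫. A second-order Taylor expansion therefore multiplies the
characteristic function at u by about 1 - u² k ς² / 2, with an error governed by the fluctuation of
the conditional variance around k ς² and by a third moment. The product of these factors tends to
exp(-t²/2).

Two facts make the errors vanish. By Parseval and domination by ν, the quadratic form of Σ is
bounded by a constant independent of m (`integral_inner_scoreVec_sq_le`) while ς → ∞, which makes
the conditional variance concentrate (`integral_abs_cov_partialSum_sub_le`). Moreover E‖X_i‖⁴ = O((∑
τ_j)²) = o(n) (`integral_norm_scoreVec_pow_four_le`). Slutsky's theorem then joins the U-statistic,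
the drift and the remainder in `tendstoInDistribution_normSq`. -/

lemma norm_cexp_mul_I_sub_taylor_le (x : ℝ) :
    ‖Complex.exp (x * Complex.I) - (1 + x * Complex.I - x ^ 2 / 2)‖ ≤ 4 * |x| ^ 3 := by
  have hsum : (1 + x * Complex.I - x ^ 2 / 2 : ℂ)
      = ∑ m ∈ Finset.range 3, (x * Complex.I) ^ m / (m.factorial : ℂ) := by
    simp [Finset.sum_range_succ, Nat.factorial, mul_pow]
    ring
  have hnorm : ‖(x * Complex.I : ℂ)‖ = |x| := by simp
  -- For |x| ≤ 1 the exponential remainder costs a factor e ≤ 4; for |x| > 1 the triangle inequality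
  -- gives 2 + |x| + x²/2, which is below 4|x|³.
  rcases le_or_gt |x| 1 with h | h
  · rw [hsum]
    refine (Complex.norm_exp_sub_sum_le_norm_mul_exp _ 3).trans ?_
    rw [hnorm, mul_comm]
    have : Real.exp |x| ≤ 4 :=
      (Real.exp_le_exp.2 h).trans (Real.exp_one_lt_d9.le.trans (by norm_num))
    gcongr
  · have h1 : ‖Complex.exp (x * Complex.I)‖ = 1 := Complex.norm_exp_ofReal_mul_I x
    have h2 : ‖(1 + x * Complex.I - x ^ 2 / 2 : ℂ)‖ ≤ 1 + |x| + |x| ^ 2 / 2 := by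
      refine (norm_sub_le _ _).trans ?_
      refine add_le_add ((norm_add_le _ _).trans ?_) ?_
      · simp
      · simp
    refine (norm_sub_le _ _).trans ?_
    rw [h1]
    refine (add_le_add_right h2 1).trans ?_
    nlinarith [sq_nonneg (|x| - 1), mul_pos (sub_pos.2 h) (sub_pos.2 h),
      mul_pos (mul_pos (sub_pos.2 h) (sub_pos.2 h)) (sub_pos.2 h)]

variable {Ω : Type*} [MeasurableSpace Ω] {P : Measure Ω}

lemma integral_abs_mul_le_sqrt {f g : Ω → ℝ} (hf : MemLp f 2 P) (hg : MemLp g 2 P) :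
    ∫ ω, |f ω * g ω| ∂P ≤ √(∫ ω, f ω ^ 2 ∂P) * √(∫ ω, g ω ^ 2 ∂P) := by
  have h := integral_mul_norm_le_Lp_mul_Lq (μ := P) (f := f) (g := g)
    Real.HolderConjugate.two_two (by simpa using hf) (by simpa using hg)
  simpa [abs_mul, Real.sqrt_eq_rpow] using h

lemma integral_abs_le_sqrt [IsProbabilityMeasure P] {f : Ω → ℝ} (hf : MemLp f 2 P) :
    ∫ ω, |f ω| ∂P ≤ √(∫ ω, f ω ^ 2 ∂P) := by
  simpa using integral_abs_mul_le_sqrt hf (memLp_const (1 : ℝ))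

lemma integral_norm_mul_norm_le_sqrt {E F : Type*} [NormedAddCommGroup E] [NormedAddCommGroup F]
    {f : Ω → E} {g : Ω → F} (hf : MemLp f 2 P) (hg : MemLp g 2 P) :
    ∫ ω, ‖f ω‖ * ‖g ω‖ ∂P ≤ √(∫ ω, ‖f ω‖ ^ 2 ∂P) * √(∫ ω, ‖g ω‖ ^ 2 ∂P) := by
  simpa [abs_mul] using integral_abs_mul_le_sqrt hf.norm hg.norm

lemma _root_.MeasureTheory.MemLp.integrable_norm_pow_of_le {E : Type*} [NormedAddCommGroup E]
    [IsFiniteMeasure P] {f : Ω → E} {p q : ℕ} (hf : MemLp f q P) (hpq : p ≤ q) :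
    Integrable (fun ω => ‖f ω‖ ^ p) P :=
  (hf.mono_exponent (by exact_mod_cast hpq)).integrable_norm_pow'

lemma memLp_four_of_integrable {E : Type*} [NormedAddCommGroup E] {f : Ω → E}
    (hf : AEStronglyMeasurable f P) (h : Integrable (fun ω => ‖f ω‖ ^ 4) P) : MemLp f 4 P := by
  refine (integrable_norm_rpow_iff hf (by norm_num) (by norm_num)).1 ?_
  have h4 : (4 : ENNReal).toReal = ((4 : ℕ) : ℝ) := by norm_num
  simpa only [h4, Real.rpow_natCast] using h

lemma memLp_two_integrable_inner {V : Type*} [NormedAddCommGroup V] [InnerProductSpace ℝ V]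
    {f g : Ω → V} (hf : MemLp f 2 P) (hg : MemLp g 2 P) :
    Integrable (fun ω => ⟪f ω, g ω⟫) P := by
  refine (hf.norm.integrable_mul hg.norm).mono' (hf.1.inner hg.1) (.of_forall fun ω => ?_)
  exact norm_inner_le_norm _ _

section Indep

variable {α β : Type*} [MeasurableSpace α] [MeasurableSpace β] {Y : Ω → α} {X : Ω → β}
  {E : Type*} [NormedAddCommGroup E]

lemma integrable_prod_of_indepFun [IsFiniteMeasure P] (h : IndepFun Y X P) (hY : Measurable Y)
    (hX : Measurable X) {F : α × β → E} (hF : StronglyMeasurable F)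
    (hint : Integrable (fun ω => F (Y ω, X ω)) P) :
    Integrable F ((P.map Y).prod (P.map X)) := by
  rw [← h.map_prod_eq_prod_map_map hY.aemeasurable hX.aemeasurable]
  exact (integrable_map_measure hF.aestronglyMeasurable (hY.prodMk hX).aemeasurable).2 hint

variable [NormedSpace ℝ E]

/-- Fubini on the product law. With `Y` the past and `X` a fresh observation, the inner integral is
the conditional expectation given the past. -/
lemma integral_indepFun_right [IsFiniteMeasure P] (h : IndepFun Y X P) (hY : Measurable Y)
    (hX : Measurable X) {F : α × β → E} (hF : StronglyMeasurable F)
    (hint : Integrable (fun ω => F (Y ω, X ω)) P) :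
    ∫ ω, F (Y ω, X ω) ∂P = ∫ ω, ∫ z, F (Y ω, z) ∂(P.map X) ∂P := by
  have hi := integrable_prod_of_indepFun h hY hX hF hint
  rw [← integral_map (f := fun y => ∫ z, F (y, z) ∂(P.map X)) hY.aemeasurable
    hi.integral_prod_left.aestronglyMeasurable, ← integral_prod _ hi,
    ← h.map_prod_eq_prod_map_map hY.aemeasurable hX.aemeasurable,
    integral_map (hY.prodMk hX).aemeasurable hF.aestronglyMeasurable]

/-- The other order of integration: the fresh observation is frozen at z, so moments of ⟪z, S_k⟫ can
be inserted. -/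
lemma integral_indepFun_left [IsFiniteMeasure P] (h : IndepFun Y X P) (hY : Measurable Y)
    (hX : Measurable X) {F : α × β → E} (hF : StronglyMeasurable F)
    (hint : Integrable (fun ω => F (Y ω, X ω)) P) :
    ∫ ω, F (Y ω, X ω) ∂P = ∫ z, ∫ ω, F (Y ω, z) ∂P ∂(P.map X) := by
  have hi := integrable_prod_of_indepFun h hY hX hF hint
  calc ∫ ω, F (Y ω, X ω) ∂P = ∫ p, F p ∂(P.map Y).prod (P.map X) := by
        rw [← h.map_prod_eq_prod_map_map hY.aemeasurable hX.aemeasurable,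
          integral_map (hY.prodMk hX).aemeasurable hF.aestronglyMeasurable]
    _ = ∫ z, ∫ y, F (y, z) ∂(P.map Y) ∂(P.map X) := integral_prod_symm _ hi
    _ = _ := by
        refine integral_congr_ae (.of_forall fun z => ?_)
        exact integral_map hY.aemeasurable
          (hF.comp_measurable measurable_prodMk_right).aestronglyMeasurable

end Indep

end NPIV

/-! ### Partial sums and off-diagonal sums of independent vectors. -/

namespace NPIV

set_option linter.unusedSectionVars false

section Sums

variable {V : Type*} [NormedAddCommGroup V] [InnerProductSpace ℝ V]

/-- The `k`-th partial sum of a sequence of vectors. -/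
def partialSum (x : ℕ → V) (k : ℕ) : V := ∑ i ∈ Finset.range k, x i

/-- The off-diagonal quadratic sum `∑_{j < i < k} ⟪B x_i, x_j⟫`. -/
def offDiagSum (B : V →L[ℝ] V) (x : ℕ → V) (k : ℕ) : ℝ :=
  ∑ i ∈ Finset.range k, ⟪B (x i), partialSum x i⟫

@[simp] lemma partialSum_zero (x : ℕ → V) : partialSum x 0 = 0 := by simp [partialSum]

lemma partialSum_succ (x : ℕ → V) (k : ℕ) : partialSum x (k + 1) = partialSum x k + x k :=
  Finset.sum_range_succ _ _

@[simp] lemma offDiagSum_zero (B : V →L[ℝ] V) (x : ℕ → V) : offDiagSum B x 0 = 0 := by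
  simp [offDiagSum]

lemma offDiagSum_succ (B : V →L[ℝ] V) (x : ℕ → V) (k : ℕ) :
    offDiagSum B x (k + 1) = offDiagSum B x k + ⟪B (x k), partialSum x k⟫ :=
  Finset.sum_range_succ _ _

lemma partialSum_congr {x y : ℕ → V} {k : ℕ} (h : ∀ i < k, x i = y i) :
    partialSum x k = partialSum y k :=
  Finset.sum_congr rfl fun i hi => h i (Finset.mem_range.1 hi)

lemma offDiagSum_congr (B : V →L[ℝ] V) {x y : ℕ → V} {k : ℕ} (h : ∀ i < k, x i = y i) :
    offDiagSum B x k = offDiagSum B y k :=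
  Finset.sum_congr rfl fun i hi => by
    have hi := Finset.mem_range.1 hi
    rw [h i hi, partialSum_congr fun j hj => h j (hj.trans hi)]

/-- A symmetric quadratic form evaluated at a partial sum. -/
lemma inner_partialSum_eq (B : V →L[ℝ] V) (hB : ∀ x y, ⟪B x, y⟫ = ⟪B y, x⟫) (x : ℕ → V) (k : ℕ) :
    ⟪B (partialSum x k), partialSum x k⟫
      = ∑ i ∈ Finset.range k, ⟪B (x i), x i⟫ + 2 * offDiagSum B x k := by
  induction k with
  | zero => simp
  | succ k ih =>
    rw [partialSum_succ, offDiagSum_succ, Finset.sum_range_succ, map_add, inner_add_left,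
      inner_add_right, inner_add_right, ih, hB (partialSum x k) (x k)]
    ring

lemma norm_partialSum_sq (x : ℕ → V) (k : ℕ) :
    ‖partialSum x k‖ ^ 2
      = ∑ i ∈ Finset.range k, ‖x i‖ ^ 2 + 2 * offDiagSum (ContinuousLinearMap.id ℝ V) x k := by
  have h := inner_partialSum_eq (ContinuousLinearMap.id ℝ V)
    (fun x y => real_inner_comm _ _) x k
  simpa [real_inner_self_eq_norm_sq] using h

end Sums

variable {Ω : Type*} [MeasurableSpace Ω] {P : Measure Ω}
  {V : Type*} [NormedAddCommGroup V] [InnerProductSpace ℝ V] [FiniteDimensional ℝ V]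
  [MeasurableSpace V] [BorelSpace V]

section Measurability

variable {α : Type*} [MeasurableSpace α]

@[fun_prop]
lemma measurable_partialSum {x : α → ℕ → V} (hx : ∀ i, Measurable fun a => x a i) (k : ℕ) :
    Measurable fun a => partialSum (x a) k :=
  Finset.measurable_fun_sum _ fun i _ => hx i

@[fun_prop]
lemma measurable_offDiagSum (B : V →L[ℝ] V) {x : α → ℕ → V}
    (hx : ∀ i, Measurable fun a => x a i) (k : ℕ) :
    Measurable fun a => offDiagSum B (x a) k :=
  Finset.measurable_fun_sum _ fun i _ =>
    (B.continuous.measurable.comp (hx i)).inner (measurable_partialSum hx i)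

end Measurability

/-- Both statistics are functions of X_0, …, X_{k-1} only. This replaces the filtration of a
martingale argument. -/
lemma indepFun_past (B : V →L[ℝ] V) {X : ℕ → Ω → V} (hX : ∀ i, Measurable (X i))
    (hind : iIndepFun X P) (k : ℕ) :
    IndepFun (fun ω => (offDiagSum B (X · ω) k, partialSum (X · ω) k)) (X k) P := by
  classical
  -- Extends a finite tuple to a sequence; the value 0 beyond `k` never enters the two sums.
  let w : (Finset.range k → V) → ℕ → V := fun v i => if h : i ∈ Finset.range k then v ⟨i, h⟩ else 0
  have hw : ∀ i, Measurable fun v => w v i := fun i => by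
    by_cases h : i ∈ Finset.range k
    · simp only [w, dif_pos h]
      exact measurable_pi_apply (⟨i, h⟩ : Finset.range k)
    · simp only [w, dif_neg h]
      exact measurable_const
  have hproj : Measurable fun v : ({k} : Finset ℕ) → V => v ⟨k, Finset.mem_singleton_self k⟩ :=
    measurable_pi_apply _
  have h := (hind.indepFun_finset (Finset.range k) {k} (by simp) hX).comp
    (φ := fun v => (offDiagSum B (w v) k, partialSum (w v) k))
    ((measurable_offDiagSum B hw k).prodMk (measurable_partialSum hw k)) hproj
  have hw' : ∀ ω, ∀ i < k, w (fun i => X i ω) i = X i ω := fun ω i hi => by simp [w, hi]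
  convert! h using 1
  funext ω
  simp only [Function.comp]
  rw [offDiagSum_congr B (hw' ω), partialSum_congr (hw' ω)]

lemma indepFun_partialSum {X : ℕ → Ω → V} (hX : ∀ i, Measurable (X i))
    (hind : iIndepFun X P) (k : ℕ) :
    IndepFun (fun ω => partialSum (X · ω) k) (X k) P :=
  (indepFun_past (ContinuousLinearMap.id ℝ V) hX hind k).comp measurable_snd measurable_id

lemma memLp_partialSum {X : ℕ → Ω → V} {p : ENNReal} (hX : ∀ i, MemLp (X i) p P) (k : ℕ) :
    MemLp (fun ω => partialSum (X · ω) k) p P :=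
  memLp_finsetSum _ fun i _ => hX i

lemma integral_partialSum {X : ℕ → Ω → V} (hX : ∀ i, Integrable (X i) P)
    (h0 : ∀ i, ∫ ω, X i ω ∂P = 0) (k : ℕ) : ∫ ω, partialSum (X · ω) k ∂P = 0 := by
  simp only [partialSum]
  rw [integral_finsetSum _ fun i _ => hX i]
  simp [h0]

lemma integral_inner_of_indepFun [IsFiniteMeasure P] {Y Z : Ω → V} (h : IndepFun Y Z P)
    (hY : Integrable Y P) (hZ : Integrable Z P) (h0 : ∫ ω, Z ω ∂P = 0) :
    ∫ ω, ⟪Y ω, Z ω⟫ ∂P = 0 := by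
  have := h.integral_bilin hY hZ (innerSL ℝ)
  rw [h0, map_zero] at this
  exact this

/-- The second moment of a sum of independent centred vectors is at most the sum of the second
moments. -/
lemma integral_norm_partialSum_sq_le [IsProbabilityMeasure P] {X : ℕ → Ω → V}
    (hX : ∀ i, Measurable (X i)) (hind : iIndepFun X P) (hL : ∀ i, MemLp (X i) 2 P)
    (h0 : ∀ i, ∫ ω, X i ω ∂P = 0) {b : ℝ} (hb : ∀ i, ∫ ω, ‖X i ω‖ ^ 2 ∂P ≤ b) (n : ℕ) :
    ∫ ω, ‖partialSum (X · ω) n‖ ^ 2 ∂P ≤ n * b := by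
  have hint : ∀ i, Integrable (X i) P := fun i => (hL i).integrable (by norm_num)
  induction n with
  | zero => simp
  | succ n ih =>
    have hS := memLp_partialSum hL n
    have h1 : ∀ ω, ‖partialSum (X · ω) (n + 1)‖ ^ 2 = ‖partialSum (X · ω) n‖ ^ 2
        + 2 * ⟪partialSum (X · ω) n, X n ω⟫ + ‖X n ω‖ ^ 2 := fun ω => by
      rw [partialSum_succ, norm_add_sq_real]
    have hin : Integrable (fun ω => ⟪partialSum (X · ω) n, X n ω⟫) P :=
      memLp_two_integrable_inner hS (hL n)
    simp_rw [h1]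
    rw [integral_add ((hS.integrable_norm_pow_of_le (q := 2) le_rfl).fun_add (hin.const_mul 2))
      ((hL n).integrable_norm_pow_of_le (q := 2) le_rfl),
      integral_add (hS.integrable_norm_pow_of_le (q := 2) le_rfl) (hin.const_mul 2),
      integral_const_mul, integral_inner_of_indepFun (indepFun_partialSum hX hind n)
        (hS.integrable (by norm_num)) (hint n) (h0 n)]
    push_cast
    linarith [hb n]

/-- Fourth moment of a sum of independent centred random variables. -/
lemma integral_partialSum_pow_four_le [IsProbabilityMeasure P] {X : ℕ → Ω → ℝ}
    (hX : ∀ i, Measurable (X i)) (hind : iIndepFun X P) (hL : ∀ i, MemLp (X i) 4 P)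
    (h0 : ∀ i, ∫ ω, X i ω ∂P = 0) {v q : ℝ} (hv : ∀ i, ∫ ω, X i ω ^ 2 ∂P ≤ v)
    (hq : ∀ i, ∫ ω, X i ω ^ 4 ∂P ≤ q) (n : ℕ) :
    ∫ ω, partialSum (X · ω) n ^ 4 ∂P ≤ 3 * n ^ 2 * v ^ 2 + n * q := by
  have hL2 : ∀ i, MemLp (X i) 2 P := fun i => (hL i).mono_exponent (by norm_num)
  have hv0 : 0 ≤ v := (integral_nonneg fun ω => sq_nonneg _).trans (hv 0)
  induction n with
  | zero => simp
  | succ n ih =>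
    set S : Ω → ℝ := fun ω => partialSum (X · ω) n with hSdef
    have hSm : Measurable S := measurable_partialSum (fun i => hX i) n
    have hS := memLp_partialSum hL n
    have hSX : IndepFun S (X n) P := indepFun_partialSum hX hind n
    have hpow : ∀ {f : Ω → ℝ}, MemLp f 4 P → ∀ p ≤ 4, Integrable (fun ω => f ω ^ p) P := by
      intro f hf p hp
      refine (hf.integrable_norm_pow_of_le (q := 4) hp).mono' (hf.1.pow p) (.of_forall fun ω => ?_)
      simp
    have hprod : ∀ a b : ℕ, ∫ ω, S ω ^ a * X n ω ^ b ∂P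
        = (∫ ω, S ω ^ a ∂P) * ∫ ω, X n ω ^ b ∂P := fun a b =>
      hSX.integral_fun_comp_mul_comp (f := fun x => x ^ a) (g := fun x => x ^ b)
        hSm.aemeasurable (hX n).aemeasurable (by fun_prop) (by fun_prop)
    have hprodi : ∀ a ≤ 4, ∀ b ≤ 4, Integrable (fun ω => S ω ^ a * X n ω ^ b) P :=
      fun a ha b hb => (hSX.comp (φ := fun x => x ^ a) (ψ := fun x => x ^ b)
        (by fun_prop) (by fun_prop)).integrable_mul (hpow hS a ha) (hpow (hL n) b hb)
    have hS2 : ∫ ω, S ω ^ 2 ∂P ≤ n * v := by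
      have := integral_norm_partialSum_sq_le hX hind hL2 h0 (b := v) (by simpa using hv) n
      simpa using this
    have hS1 : ∫ ω, S ω ^ 1 ∂P = 0 := by
      simpa [S] using integral_partialSum (fun i => (hL2 i).integrable (by norm_num)) h0 n
    have hX1 : ∫ ω, X n ω ^ 1 ∂P = 0 := by simpa using h0 n
    have hexp : ∀ ω, partialSum (X · ω) (n + 1) ^ 4 = S ω ^ 4 + 4 * (S ω ^ 3 * X n ω ^ 1)
        + 6 * (S ω ^ 2 * X n ω ^ 2) + 4 * (S ω ^ 1 * X n ω ^ 3) + X n ω ^ 4 := fun ω => by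
      rw [partialSum_succ]; ring
    have i1 := hpow hS 4 le_rfl
    have i2 := (hprodi 3 (by norm_num) 1 (by norm_num)).const_mul 4
    have i3 := (hprodi 2 (by norm_num) 2 (by norm_num)).const_mul 6
    have i4 := (hprodi 1 (by norm_num) 3 (by norm_num)).const_mul 4
    simp_rw [hexp]
    rw [integral_add (((i1.fun_add i2).fun_add i3).fun_add i4) (hpow (hL n) 4 le_rfl),
      integral_add ((i1.fun_add i2).fun_add i3) i4, integral_add (i1.fun_add i2) i3, integral_add i1 i2]
    simp_rw [integral_const_mul]
    rw [hprod, hprod, hprod, hS1, hX1]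
    -- The terms with a first power vanish. The surviving mixed term 6 n v² fits in the increment
    -- 3(n+1)²v² - 3n²v² = (6n+3)v².
    have h22 : (∫ ω, S ω ^ 2 ∂P) * ∫ ω, X n ω ^ 2 ∂P ≤ (n * v) * v :=
      mul_le_mul hS2 (hv n) (integral_nonneg fun ω => sq_nonneg _) (by positivity)
    push_cast
    have := hq n
    nlinarith [sq_nonneg v]

end NPIV

/-! ### Covariance operators and moments of the increments ⟪X_k, S_k⟫. -/

namespace NPIV

set_option linter.unusedSectionVars false

variable {Ω : Type*} [MeasurableSpace Ω] {P : Measure Ω} [IsProbabilityMeasure P]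
  {V : Type*} [NormedAddCommGroup V] [InnerProductSpace ℝ V] [FiniteDimensional ℝ V]
  [MeasurableSpace V] [BorelSpace V]

/-- `X` is a sequence of independent random vectors with common law `Q`, centred and with finite
fourth moment. -/
structure IsCentredSample (P : Measure Ω) (Q : Measure V) (X : ℕ → Ω → V) : Prop where
  measurable : ∀ i, Measurable (X i)
  indep : iIndepFun X P
  law : ∀ i, P.map (X i) = Q
  memLp_id : MemLp id 4 Q
  mean : ∫ x, x ∂Q = 0

/-- `‖Σ‖²` for the covariance operator `Σ` of `Q`: the squared Hilbert–Schmidt norm. -/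
noncomputable def covNormSq (Q : Measure V) : ℝ := ∫ x, ⟪covarianceOperator Q x, x⟫ ∂Q

/-- The fourth moment of the norm. -/
noncomputable def fourthMoment (Q : Measure V) : ℝ := ∫ x, ‖x‖ ^ 4 ∂Q

section Covariance

variable {Q : Measure V} [IsProbabilityMeasure Q]

lemma memLp_two_of_four {E : Type*} [NormedAddCommGroup E] {α : Type*} [MeasurableSpace α]
    {μ : Measure α} [IsFiniteMeasure μ] {f : α → E} (h : MemLp f 4 μ) : MemLp f 2 μ :=
  h.mono_exponent (by norm_num)

lemma cov_self (h : MemLp id 4 Q) (x : V) :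
    ⟪covarianceOperator Q x, x⟫ = ∫ z, ⟪x, z⟫ ^ 2 ∂Q := by
  rw [covarianceOperator_inner (memLp_two_of_four h)]
  simp_rw [pow_two]

lemma cov_symm (x y : V) : ⟪covarianceOperator Q x, y⟫ = ⟪covarianceOperator Q y, x⟫ := by
  have := isPositive_covarianceOperator (μ := Q).1 x y
  rw [real_inner_comm x]
  exact this

lemma cov_nonneg (x : V) : 0 ≤ ⟪covarianceOperator Q x, x⟫ :=
  isPositive_covarianceOperator (μ := Q).2 x

lemma covNormSq_nonneg : 0 ≤ covNormSq Q := integral_nonneg fun x => cov_nonneg x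

lemma fourthMoment_nonneg : 0 ≤ fourthMoment Q := integral_nonneg fun x => by positivity

/-- Cauchy–Schwarz in L²(Q) for the linear forms ⟪x, ·⟫ and ⟪y, ·⟫. -/
lemma cov_sq_le (h : MemLp id 4 Q) (x y : V) :
    ⟪covarianceOperator Q x, y⟫ ^ 2
      ≤ ⟪covarianceOperator Q x, x⟫ * ⟪covarianceOperator Q y, y⟫ := by
  have h2 := memLp_two_of_four h
  have hle : |⟪covarianceOperator Q x, y⟫|
      ≤ √⟪covarianceOperator Q x, x⟫ * √⟪covarianceOperator Q y, y⟫ := by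
    rw [cov_self h x, cov_self h y, covarianceOperator_inner h2]
    exact abs_integral_le_integral_abs.trans
      (integral_abs_mul_le_sqrt (h2.const_inner x) (h2.const_inner y))
  rw [← sq_abs]
  refine (pow_le_pow_left₀ (abs_nonneg _) hle 2).trans_eq ?_
  rw [mul_pow, Real.sq_sqrt (cov_nonneg x), Real.sq_sqrt (cov_nonneg y)]

/-- Taking y = Σx in `cov_sq_le` gives ‖Σx‖⁴ ≤ ⟪Σx, x⟫ · C‖Σx‖², and one divides by ‖Σx‖². -/
lemma norm_cov_sq_le (h : MemLp id 4 Q) {C : ℝ}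
    (hC : ∀ x, ⟪covarianceOperator Q x, x⟫ ≤ C * ‖x‖ ^ 2) (x : V) :
    ‖covarianceOperator Q x‖ ^ 2 ≤ C * ⟪covarianceOperator Q x, x⟫ := by
  have h1 := cov_sq_le h x (covarianceOperator Q x)
  rw [real_inner_self_eq_norm_sq] at h1
  have h2 := mul_le_mul_of_nonneg_left (hC (covarianceOperator Q x)) (cov_nonneg (Q := Q) x)
  -- If Σx = 0 no division is possible; then 0 ≤ C is needed, and the bound at any x ≠ 0 forces it.
  rcases eq_or_lt_of_le (sq_nonneg ‖covarianceOperator Q x‖) with h0 | h0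
  · rw [← h0] at h2 h1 ⊢
    by_cases hx : x = 0
    · simp [hx]
    · have h3 := hC x
      have h4 := cov_nonneg (Q := Q) x
      have h5 : 0 < ‖x‖ ^ 2 := by positivity
      have : 0 ≤ C := by
        by_contra hneg
        nlinarith
      positivity
  · nlinarith

end Covariance

namespace IsCentredSample

variable {Q : Measure V} {X : ℕ → Ω → V} (hX : IsCentredSample P Q X)

include hX

lemma isProbabilityMeasure : IsProbabilityMeasure Q := by
  rw [← hX.law 0]
  exact Measure.isProbabilityMeasure_map (hX.measurable 0).aemeasurable

lemma integral_comp {E : Type*} [NormedAddCommGroup E] [NormedSpace ℝ E] {g : V → E}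
    (hg : AEStronglyMeasurable g Q) (i : ℕ) : ∫ ω, g (X i ω) ∂P = ∫ x, g x ∂Q := by
  rw [← hX.law i] at hg ⊢
  exact (integral_map (hX.measurable i).aemeasurable hg).symm

lemma memLp (i : ℕ) : MemLp (X i) 4 P := by
  have h := hX.memLp_id
  rw [← hX.law i] at h
  exact (memLp_map_measure_iff aestronglyMeasurable_id (hX.measurable i).aemeasurable).1 h

lemma integral_eq_zero (i : ℕ) : ∫ ω, X i ω ∂P = 0 :=
  (hX.integral_comp (g := id) aestronglyMeasurable_id i).trans hX.mean

lemma memLp_partialSum (k : ℕ) : MemLp (fun ω => partialSum (X · ω) k) 4 P :=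
  NPIV.memLp_partialSum hX.memLp k

lemma indepFun_partialSum (k : ℕ) : IndepFun (fun ω => partialSum (X · ω) k) (X k) P :=
  NPIV.indepFun_partialSum hX.measurable hX.indep k

lemma measurable_partialSum (k : ℕ) : Measurable fun ω => partialSum (X · ω) k :=
  NPIV.measurable_partialSum hX.measurable k

/-- Cauchy–Schwarz on L⁴ factors would give only L². Independence of X_k and S_k factorises
E‖S_k‖⁴‖X_k‖⁴, so four moments survive. -/
lemma memLp_inner (B : V →L[ℝ] V) (k : ℕ) :
    MemLp (fun ω => ⟪B (X k ω), partialSum (X · ω) k⟫) 4 P := by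
  have hS := hX.memLp_partialSum k
  have hBX : Measurable fun ω => B (X k ω) := B.continuous.measurable.comp (hX.measurable k)
  have hm : Measurable fun ω => ⟪B (X k ω), partialSum (X · ω) k⟫ :=
    hBX.inner (hX.measurable_partialSum k)
  refine memLp_four_of_integrable hm.aestronglyMeasurable ?_
  have hi : Integrable (fun ω => ‖partialSum (X · ω) k‖ ^ 4 * ‖X k ω‖ ^ 4) P :=
    ((hX.indepFun_partialSum k).comp (φ := fun x => ‖x‖ ^ 4) (ψ := fun x => ‖x‖ ^ 4)
      (by fun_prop) (by fun_prop)).integrable_mul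
      (hS.integrable_norm_pow_of_le (q := 4) le_rfl)
      ((hX.memLp k).integrable_norm_pow_of_le (q := 4) le_rfl)
  refine (hi.const_mul (‖B‖ ^ 4)).mono' (hm.norm.pow_const 4).aestronglyMeasurable
    (.of_forall fun ω => ?_)
  rw [Real.norm_of_nonneg (by positivity)]
  calc ‖⟪B (X k ω), partialSum (X · ω) k⟫‖ ^ 4
      ≤ ((‖B‖ * ‖X k ω‖) * ‖partialSum (X · ω) k‖) ^ 4 := by
        gcongr
        exact (norm_inner_le_norm _ _).trans (by gcongr; exact B.le_opNorm _)
    _ = _ := by ring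

lemma memLp_offDiagSum (B : V →L[ℝ] V) (k : ℕ) : MemLp (fun ω => offDiagSum B (X · ω) k) 4 P :=
  memLp_finsetSum _ fun i _ => hX.memLp_inner B i

lemma indep_real {g : V → ℝ} (hg : Measurable g) : iIndepFun (fun i ω => g (X i ω)) P :=
  hX.indep.comp (fun _ => g) fun _ => hg

lemma integral_inner_partialSum_sq_le (z : V) (k : ℕ) :
    ∫ ω, ⟪z, partialSum (X · ω) k⟫ ^ 2 ∂P ≤ k * ⟪covarianceOperator Q z, z⟫ := by
  have := hX.isProbabilityMeasure
  have h := integral_norm_partialSum_sq_le (X := fun i ω => ⟪z, X i ω⟫)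
    (fun i => measurable_const.inner (hX.measurable i))
    (hX.indep_real (g := fun x => ⟪z, x⟫) (by fun_prop))
    (fun i => (memLp_two_of_four (hX.memLp i)).const_inner z)
    (fun i => by
      rw [integral_inner ((hX.memLp i).integrable (by norm_num)), hX.integral_eq_zero]
      simp)
    (b := ⟪covarianceOperator Q z, z⟫)
    (fun i => by
      rw [cov_self hX.memLp_id, ← hX.integral_comp (g := fun x => ⟪z, x⟫ ^ 2) (by fun_prop) i]
      simp) k
  have hs : ∀ ω, partialSum (fun i => ⟪z, X i ω⟫) k = ⟪z, partialSum (X · ω) k⟫ := fun ω => by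
    simp [partialSum, inner_sum]
  simpa [hs] using h

lemma integral_inner_partialSum_pow_four_le (z : V) (k : ℕ) :
    ∫ ω, ⟪z, partialSum (X · ω) k⟫ ^ 4 ∂P
      ≤ 3 * k ^ 2 * ⟪covarianceOperator Q z, z⟫ ^ 2 + k * (fourthMoment Q * ‖z‖ ^ 4) := by
  have := hX.isProbabilityMeasure
  have h := integral_partialSum_pow_four_le (X := fun i ω => ⟪z, X i ω⟫)
    (fun i => measurable_const.inner (hX.measurable i))
    (hX.indep_real (g := fun x => ⟪z, x⟫) (by fun_prop))
    (fun i => (hX.memLp i).const_inner z)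
    (fun i => by
      rw [integral_inner ((hX.memLp i).integrable (by norm_num)), hX.integral_eq_zero]
      simp)
    (v := ⟪covarianceOperator Q z, z⟫) (q := fourthMoment Q * ‖z‖ ^ 4)
    (fun i => by
      rw [cov_self hX.memLp_id, ← hX.integral_comp (g := fun x => ⟪z, x⟫ ^ 2) (by fun_prop) i])
    (fun i => by
      rw [hX.integral_comp (g := fun x => ⟪z, x⟫ ^ 4) (by fun_prop) i, fourthMoment,
        ← integral_mul_const]
      refine integral_mono_of_nonneg (.of_forall fun x => by positivity)
        ((hX.memLp_id.integrable_norm_pow_of_le (q := 4) le_rfl).mul_const _)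
        (.of_forall fun x => ?_)
      have h1 : |⟪z, x⟫| ≤ ‖z‖ * ‖x‖ := abs_real_inner_le_norm z x
      calc ⟪z, x⟫ ^ 4 = |⟪z, x⟫| ^ 4 := (Even.pow_abs (by decide) _).symm
        _ ≤ (‖z‖ * ‖x‖) ^ 4 := by gcongr
        _ = ‖x‖ ^ 4 * ‖z‖ ^ 4 := by ring) k
  have hs : ∀ ω, partialSum (fun i => ⟪z, X i ω⟫) k = ⟪z, partialSum (X · ω) k⟫ := fun ω => by
    simp [partialSum, inner_sum]
  simpa [hs] using h

lemma integrable_inner_sq (B : V →L[ℝ] V) (k : ℕ) :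
    Integrable (fun ω => ⟪B (X k ω), partialSum (X · ω) k⟫ ^ 2) P := by
  simpa using (hX.memLp_inner B k).integrable_norm_pow_of_le (p := 2) (q := 4) (by norm_num)

lemma integrable_inner_pow_four (B : V →L[ℝ] V) (k : ℕ) :
    Integrable (fun ω => ⟪B (X k ω), partialSum (X · ω) k⟫ ^ 4) P := by
  have := (hX.memLp_inner B k).integrable_norm_pow_of_le (p := 4) (q := 4) le_rfl
  simpa [Even.pow_abs (show Even 4 by decide)] using this

lemma integrable_cov_self : Integrable (fun x => ⟪covarianceOperator Q x, x⟫) Q := by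
  have := hX.isProbabilityMeasure
  have h2 := memLp_two_of_four hX.memLp_id
  exact memLp_two_integrable_inner ((covarianceOperator Q).comp_memLp' h2) h2

/-- Given S_k = s, the increment has second moment ⟪Σs, s⟫, its conditional variance. -/
lemma integral_inner_sq_eq (k : ℕ) :
    ∫ ω, ⟪X k ω, partialSum (X · ω) k⟫ ^ 2 ∂P
      = ∫ ω, ⟪covarianceOperator Q (partialSum (X · ω) k), partialSum (X · ω) k⟫ ∂P := by
  have := hX.isProbabilityMeasure
  rw [integral_indepFun_right (hX.indepFun_partialSum k) (hX.measurable_partialSum k)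
    (hX.measurable k) (F := fun p : V × V => ⟪p.2, p.1⟫ ^ 2) (by fun_prop)
    (hX.integrable_inner_sq (ContinuousLinearMap.id ℝ V) k), hX.law k]
  simp_rw [cov_self hX.memLp_id, real_inner_comm]

/-- Averaging over S_k first, with X_k = z frozen, gives at most k⟪Σz, z⟫, whose mean is k‖Σ‖². -/
lemma integral_inner_sq_le (k : ℕ) :
    ∫ ω, ⟪X k ω, partialSum (X · ω) k⟫ ^ 2 ∂P ≤ k * covNormSq Q := by
  have := hX.isProbabilityMeasure
  rw [integral_indepFun_left (hX.indepFun_partialSum k) (hX.measurable_partialSum k)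
    (hX.measurable k) (F := fun p : V × V => ⟪p.2, p.1⟫ ^ 2) (by fun_prop)
    (hX.integrable_inner_sq (ContinuousLinearMap.id ℝ V) k), hX.law k, covNormSq,
    ← integral_const_mul]
  exact integral_mono_of_nonneg (.of_forall fun x => integral_nonneg fun ω => sq_nonneg _)
    (hX.integrable_cov_self.const_mul _)
    (.of_forall fun z => hX.integral_inner_partialSum_sq_le z k)

lemma integral_cov_partialSum_le (k : ℕ) :
    ∫ ω, ⟪covarianceOperator Q (partialSum (X · ω) k), partialSum (X · ω) k⟫ ∂P
      ≤ k * covNormSq Q :=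
  (hX.integral_inner_sq_eq k).symm.trans_le (hX.integral_inner_sq_le k)

variable {C : ℝ} (hC : ∀ x, ⟪covarianceOperator Q x, x⟫ ≤ C * ‖x‖ ^ 2)

include hC

lemma cov_sq_le_norm (x : V) : ⟪covarianceOperator Q x, x⟫ ^ 2 ≤ C ^ 2 * ‖x‖ ^ 4 := by
  have := hX.isProbabilityMeasure
  refine (pow_le_pow_left₀ (cov_nonneg x) (hC x) 2).trans_eq ?_
  ring

/-- With X_k = z frozen this is the scalar fourth-moment bound, and ⟪Σz, z⟫² ≤ C²‖z‖⁴ makes both of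
its terms multiples of ‖z‖⁴. -/
lemma integral_inner_pow_four_le (k : ℕ) :
    ∫ ω, ⟪X k ω, partialSum (X · ω) k⟫ ^ 4 ∂P
      ≤ 3 * k ^ 2 * (C ^ 2 * fourthMoment Q) + k * fourthMoment Q ^ 2 := by
  have := hX.isProbabilityMeasure
  have hi := hX.memLp_id.integrable_norm_pow_of_le (q := 4) le_rfl
  rw [integral_indepFun_left (hX.indepFun_partialSum k) (hX.measurable_partialSum k)
    (hX.measurable k) (F := fun p : V × V => ⟪p.2, p.1⟫ ^ 4) (by fun_prop)
    (hX.integrable_inner_pow_four (ContinuousLinearMap.id ℝ V) k), hX.law k]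
  calc ∫ z, ∫ ω, ⟪z, partialSum (X · ω) k⟫ ^ 4 ∂P ∂Q
      ≤ ∫ z, (3 * k ^ 2 * C ^ 2 + k * fourthMoment Q) * ‖z‖ ^ 4 ∂Q := by
        refine integral_mono_of_nonneg (.of_forall fun x => integral_nonneg fun ω => by positivity)
          (hi.const_mul _) (.of_forall fun z => ?_)
        refine (hX.integral_inner_partialSum_pow_four_le z k).trans ?_
        have h1 := mul_le_mul_of_nonneg_left (hX.cov_sq_le_norm hC z)
          (show (0 : ℝ) ≤ 3 * k ^ 2 by positivity)
        linarith
    _ = _ := by rw [integral_const_mul, ← fourthMoment]; ring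

/-- Given S_k = s the mean is ⟪Σ(Σs), Σs⟫ ≤ C‖Σs‖² ≤ C²⟪Σs, s⟫. The extra Σ thus costs only the
bounded factor C², not another Hilbert–Schmidt norm. -/
lemma integral_inner_cov_sq_le (k : ℕ) :
    ∫ ω, ⟪covarianceOperator Q (X k ω), partialSum (X · ω) k⟫ ^ 2 ∂P
      ≤ C ^ 2 * (k * covNormSq Q) := by
  have := hX.isProbabilityMeasure
  rw [integral_indepFun_right (hX.indepFun_partialSum k) (hX.measurable_partialSum k)
    (hX.measurable k) (F := fun p : V × V => ⟪covarianceOperator Q p.2, p.1⟫ ^ 2) (by fun_prop)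
    (hX.integrable_inner_sq (covarianceOperator Q) k), hX.law k]
  have h2 := memLp_two_of_four (hX.memLp_partialSum k)
  have hle : ∀ s : V, ∫ z, ⟪covarianceOperator Q z, s⟫ ^ 2 ∂Q
      ≤ C ^ 2 * ⟪covarianceOperator Q s, s⟫ := fun s => by
    simp_rw [cov_symm _ s]
    rw [← cov_self hX.memLp_id]
    by_cases hs : s = 0
    · simp [hs]
    have hC0 : 0 ≤ C := nonneg_of_mul_nonneg_left ((cov_nonneg s).trans (hC s)) (by positivity)
    calc _ ≤ C * ‖covarianceOperator Q s‖ ^ 2 := hC _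
      _ ≤ C * (C * ⟪covarianceOperator Q s, s⟫) := by
        gcongr
        exact norm_cov_sq_le hX.memLp_id hC s
      _ = _ := by ring
  calc _ ≤ ∫ ω, C ^ 2 * ⟪covarianceOperator Q (partialSum (X · ω) k), partialSum (X · ω) k⟫ ∂P :=
        integral_mono_of_nonneg (.of_forall fun x => integral_nonneg fun ω => sq_nonneg _)
          ((memLp_two_integrable_inner ((covarianceOperator Q).comp_memLp' h2) h2).const_mul _)
          (.of_forall fun ω => hle _)
    _ ≤ _ := by
      rw [integral_const_mul]
      gcongr
      exact hX.integral_cov_partialSum_le k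

/-- ΣX_k is centred and independent of the past, so the increments are orthogonal and their second
moments, each at most i C²‖Σ‖², add up. -/
lemma integral_offDiagSum_cov_sq_le (k : ℕ) :
    ∫ ω, offDiagSum (covarianceOperator Q) (X · ω) k ^ 2 ∂P ≤ k ^ 2 * (C ^ 2 * covNormSq Q) := by
  have := hX.isProbabilityMeasure
  set A := covarianceOperator Q
  induction k with
  | zero => simp
  | succ k ih =>
    have hN := memLp_two_of_four (hX.memLp_offDiagSum A k)
    have hD := memLp_two_of_four (hX.memLp_inner A k)
    have hND : Integrable
        (fun ω => offDiagSum A (X · ω) k * ⟪A (X k ω), partialSum (X · ω) k⟫) P :=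
      hN.integrable_mul hD
    have hcross : ∫ ω, offDiagSum A (X · ω) k * ⟪A (X k ω), partialSum (X · ω) k⟫ ∂P = 0 := by
      rw [integral_indepFun_right (indepFun_past A hX.measurable hX.indep k)
        ((measurable_offDiagSum A hX.measurable k).prodMk (hX.measurable_partialSum k))
        (hX.measurable k) (F := fun p : (ℝ × V) × V => p.1.1 * ⟪A p.2, p.1.2⟫) (by fun_prop)
        hND, hX.law k]
      refine (integral_congr_ae (.of_forall fun ω => ?_)).trans (integral_zero _ _)
      have hid : Integrable (fun z : V => z) Q := hX.memLp_id.integrable (by norm_num)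
      have hint : Integrable (fun z => A z) Q := A.integrable_comp hid
      change ∫ z, offDiagSum A (X · ω) k * ⟪A z, partialSum (X · ω) k⟫ ∂Q = 0
      have hcomm : (fun z => ⟪A z, partialSum (X · ω) k⟫) = fun z => ⟪partialSum (X · ω) k, A z⟫ :=
        funext fun z => real_inner_comm _ _
      rw [integral_const_mul, hcomm, integral_inner hint, A.integral_comp_comm hid]
      simp [hX.mean]
    have hsq : ∀ ω, offDiagSum A (X · ω) (k + 1) ^ 2 = offDiagSum A (X · ω) k ^ 2
        + 2 * (offDiagSum A (X · ω) k * ⟪A (X k ω), partialSum (X · ω) k⟫)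
        + ⟪A (X k ω), partialSum (X · ω) k⟫ ^ 2 := fun ω => by
      rw [offDiagSum_succ]; ring
    simp_rw [hsq]
    rw [integral_add (hN.integrable_sq.fun_add (hND.const_mul 2))
      hD.integrable_sq, integral_add hN.integrable_sq (hND.const_mul 2),
      integral_const_mul, hcross]
    have h1 := hX.integral_inner_cov_sq_le hC k
    have h0 : 0 ≤ C ^ 2 * covNormSq Q := mul_nonneg (sq_nonneg _) covNormSq_nonneg
    push_cast
    nlinarith [mul_nonneg (Nat.cast_nonneg (α := ℝ) k) h0]

/-- The conditional variance of the `k`-th increment concentrates around its mean. -/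
lemma integral_abs_cov_partialSum_sub_le (hC0 : 0 ≤ C) (k : ℕ) :
    ∫ ω, |⟪covarianceOperator Q (partialSum (X · ω) k), partialSum (X · ω) k⟫
        - k * covNormSq Q| ∂P
      ≤ C * √(k * fourthMoment Q) + 2 * (k * (C * √(covNormSq Q))) := by
  have := hX.isProbabilityMeasure
  set A := covarianceOperator Q
  have h2 : ∀ i, MemLp (X i) 2 P := fun i => memLp_two_of_four (hX.memLp i)
  let g : V → ℝ := fun x => ⟪A x, x⟫ - covNormSq Q
  have hgm : Measurable g := by fun_prop
  have hi4 := hX.memLp_id.integrable_norm_pow_of_le (q := 4) le_rfl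
  have hc2i : Integrable (fun x => ⟪A x, x⟫ ^ 2) Q :=
    (hi4.const_mul (C ^ 2)).mono' (by fun_prop) (.of_forall fun x => by
      rw [Real.norm_of_nonneg (sq_nonneg _)]
      exact hX.cov_sq_le_norm hC x)
  have hcL : MemLp (fun x => ⟪A x, x⟫) 2 Q := (memLp_two_iff_integrable_sq (by fun_prop)).2 hc2i
  have hgL : MemLp g 2 Q := hcL.sub (memLp_const _)
  have hgL' : ∀ i, MemLp (fun ω => g (X i ω)) 2 P := fun i => by
    have h := hgL
    rw [← hX.law i] at h
    exact (memLp_map_measure_iff hgm.aestronglyMeasurable (hX.measurable i).aemeasurable).1 h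
  have hg0 : ∫ x, g x ∂Q = 0 := by
    simp only [g]
    rw [integral_sub hX.integrable_cov_self (integrable_const _)]
    simp [covNormSq]
  have hgb : ∫ x, g x ^ 2 ∂Q ≤ C ^ 2 * fourthMoment Q := by
    have hvar : ∫ x, g x ^ 2 ∂Q ≤ ∫ x, ⟪A x, x⟫ ^ 2 ∂Q := by
      have hexp : ∀ x, g x ^ 2 = ⟪A x, x⟫ ^ 2 - 2 * covNormSq Q * g x - covNormSq Q ^ 2 :=
        fun x => by simp only [g]; ring
      simp_rw [hexp]
      have hgi := (hgL.integrable (by norm_num)).const_mul (2 * covNormSq Q)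
      rw [integral_sub (hc2i.sub' hgi) (integrable_const _), integral_sub hc2i hgi,
        integral_const_mul, hg0]
      simp only [mul_zero, sub_zero, integral_const, probReal_univ, one_smul]
      linarith [sq_nonneg (covNormSq Q)]
    refine hvar.trans ?_
    rw [fourthMoment, ← integral_const_mul]
    exact integral_mono hc2i (hi4.const_mul _) fun x => hX.cov_sq_le_norm hC x
  have hdiag := integral_norm_partialSum_sq_le (X := fun i ω => g (X i ω))
    (fun i => hgm.comp (hX.measurable i)) (hX.indep_real hgm) hgL'
    (fun i => (hX.integral_comp hgm.aestronglyMeasurable i).trans hg0)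
    (b := C ^ 2 * fourthMoment Q)
    (fun i => by
      simp only [Real.norm_eq_abs, sq_abs]
      exact (hX.integral_comp (g := fun x => g x ^ 2) (by fun_prop) i).trans_le hgb) k
  simp only [Real.norm_eq_abs, sq_abs] at hdiag
  have hGL := NPIV.memLp_partialSum hgL' k
  have hN := memLp_two_of_four (hX.memLp_offDiagSum A k)
  -- The diagonal part is a sum of independent centred variables, of size √k. The off-diagonal part
  -- is of size k C‖Σ‖, small against the mean k‖Σ‖² because ‖Σ‖ → ∞ in the application.
  have hdec : ∀ ω, ⟪A (partialSum (X · ω) k), partialSum (X · ω) k⟫ - k * covNormSq Q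
      = partialSum (fun i => g (X i ω)) k + 2 * offDiagSum A (X · ω) k := fun ω => by
    rw [inner_partialSum_eq A (fun x y => cov_symm x y)]
    simp [partialSum, g, Finset.sum_sub_distrib]
    ring
  simp_rw [hdec]
  have hG1 := (hGL.integrable (by norm_num)).abs
  have hN1 := ((hN.integrable (by norm_num)).abs).const_mul 2
  calc _ ≤ ∫ ω, (|partialSum (fun i => g (X i ω)) k| + 2 * |offDiagSum A (X · ω) k|) ∂P := by
        refine integral_mono_of_nonneg (.of_forall fun x => abs_nonneg _) (hG1.fun_add hN1)
          (.of_forall fun ω => ?_)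
        refine (abs_add_le _ _).trans_eq ?_
        rw [abs_mul, abs_of_pos (two_pos : (0 : ℝ) < 2)]
    _ = ∫ ω, |partialSum (fun i => g (X i ω)) k| ∂P + 2 * ∫ ω, |offDiagSum A (X · ω) k| ∂P := by
        rw [integral_add hG1 hN1, integral_const_mul]
    _ ≤ √(k * (C ^ 2 * fourthMoment Q)) + 2 * √(k ^ 2 * (C ^ 2 * covNormSq Q)) := by
        gcongr
        · exact (integral_abs_le_sqrt hGL).trans (Real.sqrt_le_sqrt hdiag)
        · exact (integral_abs_le_sqrt hN).trans
            (Real.sqrt_le_sqrt (hX.integral_offDiagSum_cov_sq_le hC k))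
    _ = _ := by
        rw [show (k : ℝ) * (C ^ 2 * fourthMoment Q) = C ^ 2 * (k * fourthMoment Q) by ring,
          Real.sqrt_mul (sq_nonneg _), Real.sqrt_sq hC0, Real.sqrt_mul (sq_nonneg _),
          Real.sqrt_mul (sq_nonneg _), Real.sqrt_sq hC0, Real.sqrt_sq (Nat.cast_nonneg k)]

end IsCentredSample

end NPIV

/-! ### Recursion for the characteristic function of the U-statistic. -/

namespace NPIV

set_option linter.unusedSectionVars false

/-- From 1 - p ≤ e^{-p} ≤ 1/(1+p) and 1/(1+p) - (1-p) = p²/(1+p). -/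
lemma abs_exp_neg_sub_le {p : ℝ} (hp : 0 ≤ p) : |Real.exp (-p) - (1 - p)| ≤ p ^ 2 := by
  have h1 := Real.add_one_le_exp (-p)
  have h2 : Real.exp (-p) * (1 + p) ≤ 1 := by
    have h3 := mul_le_mul_of_nonneg_left (Real.add_one_le_exp p) (Real.exp_pos (-p)).le
    rw [← Real.exp_add, neg_add_cancel, Real.exp_zero] at h3
    linarith
  rw [abs_of_nonneg (by linarith)]
  nlinarith [pow_nonneg hp 3]

/-- A sequence that is multiplied approximately by `1 - p_k` at each step is close to
`exp (-∑ p_k)`. -/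
lemma norm_sub_exp_neg_sum_le {φ : ℕ → ℂ} {p : ℕ → ℝ} {ε q : ℝ} {n : ℕ} (h0 : φ 0 = 1)
    (hφ : ∀ k, ‖φ k‖ ≤ 1) (hp : ∀ k, 0 ≤ p k) (hq : ∀ k < n, p k ≤ q)
    (hstep : ∀ k < n, ‖φ (k + 1) - (1 - p k : ℝ) * φ k‖ ≤ ε) :
    ‖φ n - Real.exp (-∑ k ∈ Finset.range n, p k)‖ ≤ n * (ε + q ^ 2) := by
  induction n with
  | zero => simp [h0]
  | succ n ih =>
    have ih := ih (fun k hk => hq k (by omega)) fun k hk => hstep k (by omega)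
    set E := Real.exp (-∑ k ∈ Finset.range n, p k)
    have hE : Real.exp (-∑ k ∈ Finset.range (n + 1), p k) = Real.exp (-p n) * E := by
      rw [Finset.sum_range_succ, neg_add, add_comm, Real.exp_add]
    -- Three errors: the step itself, the replacement of 1 - p by e^{-p}, and the earlier error,
    -- which is not enlarged since e^{-p} ≤ 1.
    have hdec : φ (n + 1) - (Real.exp (-p n) * E : ℝ)
        = (φ (n + 1) - (1 - p n : ℝ) * φ n) - (Real.exp (-p n) - (1 - p n) : ℝ) * φ n
          + (Real.exp (-p n) : ℝ) * (φ n - E) := by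
      push_cast
      ring
    have h1 : ‖((Real.exp (-p n) - (1 - p n) : ℝ) : ℂ) * φ n‖ ≤ q ^ 2 := by
      rw [norm_mul, Complex.norm_real, Real.norm_eq_abs]
      calc _ ≤ p n ^ 2 * 1 := mul_le_mul (abs_exp_neg_sub_le (hp n)) (hφ n) (norm_nonneg _)
              (sq_nonneg _)
        _ ≤ q ^ 2 := by
          rw [mul_one]
          exact pow_le_pow_left₀ (hp n) (hq n (by omega)) 2
    have h2 : ‖((Real.exp (-p n) : ℝ) : ℂ) * (φ n - E)‖ ≤ n * (ε + q ^ 2) := by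
      rw [norm_mul, Complex.norm_real, Real.norm_of_nonneg (Real.exp_pos _).le]
      refine (mul_le_of_le_one_left (norm_nonneg _) ?_).trans ih
      exact Real.exp_le_one_iff.2 (neg_nonpos.2 (hp n))
    rw [hE, hdec]
    refine (norm_add_le _ _).trans ((add_le_add (norm_sub_le _ _) le_rfl).trans ?_)
    have h3 := hstep n (by omega)
    rw [Nat.cast_succ]
    linarith

namespace IsCentredSample

variable {Ω : Type*} [MeasurableSpace Ω] {P : Measure Ω} [IsProbabilityMeasure P]
  {V : Type*} [NormedAddCommGroup V] [InnerProductSpace ℝ V] [FiniteDimensional ℝ V]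
  [MeasurableSpace V] [BorelSpace V]
  {Q : Measure V} {X : ℕ → Ω → V} (hX : IsCentredSample P Q X)

include hX

/-- The characteristic function of the off-diagonal sum changes by the factor
`1 - u² k ‖Σ‖² / 2` at the `k`-th step, up to a small error. -/
lemma norm_charFun_step_le (u : ℝ) (k : ℕ) :
    ‖∫ ω, Complex.exp ((u * offDiagSum (.id ℝ V) (X · ω) (k + 1) : ℝ) * Complex.I) ∂P
      - (1 - u ^ 2 * k * covNormSq Q / 2 : ℝ)
        * ∫ ω, Complex.exp ((u * offDiagSum (.id ℝ V) (X · ω) k : ℝ) * Complex.I) ∂P‖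
    ≤ u ^ 2 / 2 * ∫ ω, |⟪covarianceOperator Q (partialSum (X · ω) k), partialSum (X · ω) k⟫
        - k * covNormSq Q| ∂P
      + 4 * ∫ ω, |u * ⟪X k ω, partialSum (X · ω) k⟫| ^ 3 ∂P := by
  have := hX.isProbabilityMeasure
  set A := covarianceOperator Q
  set N : Ω → ℝ := fun ω => offDiagSum (.id ℝ V) (X · ω) k with hN
  set S : Ω → V := fun ω => partialSum (X · ω) k with hS
  set D : Ω → ℝ := fun ω => ⟪X k ω, S ω⟫ with hD
  have hNm : Measurable N := measurable_offDiagSum _ hX.measurable k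
  have hSm : Measurable S := hX.measurable_partialSum k
  have hXm : Measurable (X k) := hX.measurable k
  have hDm : Measurable D := hXm.inner hSm
  have hDL : MemLp D 4 P := hX.memLp_inner (.id ℝ V) k
  have hD1 : Integrable D P := hDL.integrable (by norm_num)
  have hD2 : Integrable (fun ω => D ω ^ 2) P := hX.integrable_inner_sq (.id ℝ V) k
  have hD3 : Integrable (fun ω => |u * D ω| ^ 3) P :=
    (hDL.const_mul u).integrable_norm_pow_of_le (p := 3) (q := 4) (by norm_num)
  set e : Ω → ℂ := fun ω => Complex.exp ((u * N ω : ℝ) * Complex.I) with he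
  have hem : Measurable e := by fun_prop
  have hen : ∀ ω, ‖e ω‖ = 1 := fun ω => Complex.norm_exp_ofReal_mul_I _
  have hei : Integrable e P := (integrable_const (1 : ℝ)).mono' hem.aestronglyMeasurable
    (.of_forall fun ω => (hen ω).le)
  -- The second-order Taylor polynomial of exp(iux).
  let T : ℝ → ℂ := fun x => 1 + (u * x : ℝ) * Complex.I - ((u * x : ℝ) : ℂ) ^ 2 / 2
  have hTi : Integrable (fun ω => T (D ω)) P := by
    refine ((integrable_const 1).fun_add ((hD1.const_mul u).ofReal.mul_const Complex.I)).sub' ?_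
    have h : Integrable (fun ω => ((u ^ 2 * D ω ^ 2 : ℝ) : ℂ)) P := (hD2.const_mul (u ^ 2)).ofReal
    refine (h.div_const 2).congr (.of_forall fun ω => ?_)
    push_cast
    ring
  have heTi : Integrable (fun ω => e ω * T (D ω)) P :=
    hTi.bdd_mul hem.aestronglyMeasurable (.of_forall fun ω => (hen ω).le)
  -- Integrating out X_k with the past fixed kills the linear term by centring and turns the
  -- quadratic one into ⟪ΣS_k, S_k⟫.
  have hT : ∫ ω, e ω * T (D ω) ∂P = ∫ ω, e ω * (1 - u ^ 2 / 2 * ⟪A (S ω), S ω⟫ : ℝ) ∂P := by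
    rw [integral_indepFun_right (indepFun_past (.id ℝ V) hX.measurable hX.indep k)
      (hNm.prodMk hSm) hXm
      (F := fun p : (ℝ × V) × V => Complex.exp ((u * p.1.1 : ℝ) * Complex.I) * T ⟪p.2, p.1.2⟫)
      (by fun_prop) heTi, hX.law k]
    refine integral_congr_ae (.of_forall fun ω => ?_)
    change ∫ z, e ω * T ⟪z, S ω⟫ ∂Q = _
    rw [integral_const_mul]
    congr 1
    have hid : Integrable (fun z : V => z) Q := hX.memLp_id.integrable (by norm_num)
    have hi1 : Integrable (fun z => ⟪z, S ω⟫) Q := hid.inner_const _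
    have hi2 : Integrable (fun z => ⟪S ω, z⟫ ^ 2) Q :=
      ((memLp_two_of_four hX.memLp_id).const_inner (S ω)).integrable_sq
    have hTz : ∀ z, T ⟪z, S ω⟫ = 1 + ((u * ⟪z, S ω⟫ : ℝ) : ℂ) * Complex.I
        - ((u ^ 2 / 2 * ⟪S ω, z⟫ ^ 2 : ℝ) : ℂ) := fun z => by
      rw [real_inner_comm z (S ω)]
      simp only [T]
      push_cast
      ring
    have hz : ∫ z, ⟪z, S ω⟫ ∂Q = 0 := by
      have hcomm : (fun z => ⟪z, S ω⟫) = fun z => ⟪S ω, z⟫ := funext fun z => real_inner_comm _ _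
      rw [hcomm, integral_inner hid, hX.mean, inner_zero_right]
    have hj1 : Integrable (fun z => ((u * ⟪z, S ω⟫ : ℝ) : ℂ) * Complex.I) Q :=
      (hi1.const_mul u).ofReal.mul_const Complex.I
    have hj2 : Integrable (fun z => ((u ^ 2 / 2 * ⟪S ω, z⟫ ^ 2 : ℝ) : ℂ)) Q :=
      (hi2.const_mul _).ofReal
    simp_rw [hTz]
    rw [integral_sub ((integrable_const 1).fun_add hj1) hj2, integral_add (integrable_const 1) hj1,
      integral_mul_const, integral_complex_ofReal, integral_complex_ofReal, integral_const_mul, integral_const_mul,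
      hz, ← cov_self hX.memLp_id]
    simp [A]
  have hASi : Integrable (fun ω => ⟪A (S ω), S ω⟫) P := by
    have h2 := memLp_two_of_four (hX.memLp_partialSum k)
    exact memLp_two_integrable_inner (A.comp_memLp' h2) h2
  have hfull : ∀ ω, Complex.exp ((u * offDiagSum (.id ℝ V) (X · ω) (k + 1) : ℝ) * Complex.I)
      = e ω * T (D ω) + e ω * (Complex.exp ((u * D ω : ℝ) * Complex.I) - T (D ω)) := fun ω => by
    rw [offDiagSum_succ, ← mul_add, add_sub_cancel, ← Complex.exp_add]
    congr 1
    simp only [N, D, S, ContinuousLinearMap.id_apply]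
    push_cast
    ring
  have hRn : ∀ ω, ‖e ω * (Complex.exp ((u * D ω : ℝ) * Complex.I) - T (D ω))‖
      ≤ 4 * |u * D ω| ^ 3 := fun ω => by
    rw [norm_mul, hen, one_mul]
    exact norm_cexp_mul_I_sub_taylor_le _
  have hRi : Integrable (fun ω => e ω * (Complex.exp ((u * D ω : ℝ) * Complex.I) - T (D ω))) P :=
    (hD3.const_mul 4).mono' (by fun_prop) (.of_forall hRn)
  have hAi : Integrable (fun ω => e ω * (1 - u ^ 2 / 2 * ⟪A (S ω), S ω⟫ : ℝ)) P := by
    refine Integrable.bdd_mul (c := 1) ?_ hem.aestronglyMeasurable (.of_forall fun ω => (hen ω).le)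
    exact ((integrable_const 1).sub' (hASi.const_mul _)).ofReal
  -- Subtracting the deterministic factor leaves the fluctuation of the conditional variance and the
  -- Taylor remainder, both multiplied by `e`, of modulus one.
  have hmain : ∫ ω, Complex.exp ((u * offDiagSum (.id ℝ V) (X · ω) (k + 1) : ℝ) * Complex.I) ∂P
      - (1 - u ^ 2 * k * covNormSq Q / 2 : ℝ) * ∫ ω, e ω ∂P
      = ∫ ω, e ω * (-(u ^ 2 / 2) * (⟪A (S ω), S ω⟫ - k * covNormSq Q) : ℝ) ∂P
        + ∫ ω, e ω * (Complex.exp ((u * D ω : ℝ) * Complex.I) - T (D ω)) ∂P := by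
    simp_rw [hfull]
    rw [integral_add heTi hRi, hT, ← integral_const_mul, add_sub_right_comm,
      ← integral_sub hAi (hei.const_mul _)]
    congr 1
    refine integral_congr_ae (.of_forall fun ω => ?_)
    push_cast
    ring
  rw [hmain]
  refine (norm_add_le _ _).trans (add_le_add ?_ ?_)
  · rw [← integral_const_mul]
    refine (norm_integral_le_integral_norm _).trans_eq
      (integral_congr_ae (.of_forall fun ω => ?_))
    simp only [norm_mul, hen, one_mul, Complex.norm_real, Real.norm_eq_abs]
    rw [abs_neg, abs_of_nonneg (by positivity : (0 : ℝ) ≤ u ^ 2 / 2)]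
  · rw [← integral_const_mul]
    exact norm_integral_le_of_norm_le (hD3.const_mul 4) (.of_forall hRn)

/-- A quantitative central limit theorem for the degenerate `U`-statistic
`∑_{i < j < n} ⟪X_i, X_j⟫`, in terms of characteristic functions. -/
theorem norm_charFun_offDiagSum_sub_le {C : ℝ} (hC0 : 0 ≤ C)
    (hC : ∀ x, ⟪covarianceOperator Q x, x⟫ ≤ C * ‖x‖ ^ 2) (hs : 0 < covNormSq Q)
    {n : ℕ} (hn : n ≠ 0) (t : ℝ) :
    ‖∫ ω, Complex.exp ((t * (√2 / (n * √(covNormSq Q)) * offDiagSum (.id ℝ V) (X · ω) n) : ℝ)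
        * Complex.I) ∂P - Real.exp (-(t ^ 2 / 2 * (1 - (n : ℝ)⁻¹)))‖
    ≤ t ^ 2 * (C * √(fourthMoment Q / n) / covNormSq Q + 2 * C / √(covNormSq Q))
      + 4 * √(8 * t ^ 6 * (3 * C ^ 2 * (fourthMoment Q / n) + (fourthMoment Q / n) ^ 2)
          / covNormSq Q ^ 2)
      + t ^ 4 / n := by
  have := hX.isProbabilityMeasure
  set s := covNormSq Q
  set L := fourthMoment Q with hL
  have hL0 : 0 ≤ L := fourthMoment_nonneg
  have hn0 : (0 : ℝ) < n := by positivity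
  have hsq : √s ^ 2 = s := Real.sq_sqrt hs.le
  have hs' : 0 < √s := Real.sqrt_pos.2 hs
  -- The increments have variances of total at most s n(n-1)/2; √2/(n√s) rescales that total to 1 -
  -- 1/n.
  set u : ℝ := t * (√2 / (n * √s)) with hu
  have hu2 : u ^ 2 = 2 * t ^ 2 / (n ^ 2 * s) := by
    rw [hu, mul_pow, div_pow, mul_pow, hsq, Real.sq_sqrt (by norm_num)]
    ring
  set φ : ℕ → ℂ := fun k =>
    ∫ ω, Complex.exp ((u * offDiagSum (.id ℝ V) (X · ω) k : ℝ) * Complex.I) ∂P with hφ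
  have h0 : φ 0 = 1 := by simp [hφ]
  have hφ1 : ∀ k, ‖φ k‖ ≤ 1 := fun k => by
    refine (norm_integral_le_of_norm_le (integrable_const (1 : ℝ))
      (.of_forall fun ω => (Complex.norm_exp_ofReal_mul_I _).le)).trans ?_
    simp
  set ε₁ := t ^ 2 * (C * √(L / n) / s + 2 * C / √s) with hε₁
  set ε₂ := 4 * √(8 * t ^ 6 * (3 * C ^ 2 * (L / n) + (L / n) ^ 2) / s ^ 2) with hε₂
  have hstep : ∀ k < n, ‖φ (k + 1) - (1 - u ^ 2 * k * s / 2 : ℝ) * φ k‖ ≤ (ε₁ + ε₂) / n := by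
    intro k hk
    have hkn : (k : ℝ) ≤ n := by exact_mod_cast hk.le
    refine (hX.norm_charFun_step_le u k).trans ?_
    rw [add_div]
    refine add_le_add ?_ ?_
    · have h1 := hX.integral_abs_cov_partialSum_sub_le hC hC0 k
      have h2 : C * √(k * L) + 2 * (k * (C * √s)) ≤ C * √(n * L) + 2 * (n * (C * √s)) := by
        gcongr
      refine (mul_le_mul_of_nonneg_left (h1.trans h2) (by positivity)).trans_eq ?_
      have h3 : √(n * L) = n * √(L / n) := by
        rw [show (n : ℝ) * L = n ^ 2 * (L / n) by field_simp, Real.sqrt_mul (sq_nonneg _),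
          Real.sqrt_sq hn0.le]
      rw [h3, hu2, hε₁]
      field_simp
      linear_combination 2 * t ^ 2 * C * hsq
    · set D : Ω → ℝ := fun ω => ⟪X k ω, partialSum (X · ω) k⟫
      have hDL : MemLp D 4 P := hX.memLp_inner (.id ℝ V) k
      have hD4 : Integrable (fun ω => D ω ^ 4) P := hX.integrable_inner_pow_four (.id ℝ V) k
      have hDm := hDL.1
      -- The third absolute moment is interpolated between the second and the fourth by writing |x|³
      -- = |x · x²|.
      have hcs := integral_abs_mul_le_sqrt (f := fun ω => u * D ω) (g := fun ω => (u * D ω) ^ 2)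
        ((memLp_two_of_four hDL).const_mul u)
        ((memLp_two_iff_integrable_sq (by fun_prop)).2
          ((hD4.const_mul (u ^ 4)).congr (.of_forall fun ω => by ring)))
      have habs : ∀ ω, |u * D ω| ^ 3 = |u * D ω * (u * D ω) ^ 2| := fun ω => by
        rw [abs_mul (u * D ω) ((u * D ω) ^ 2), abs_of_nonneg (sq_nonneg (u * D ω)), ← sq_abs (u * D ω)]
        ring
      have h2 : ∫ ω, (u * D ω) ^ 2 ∂P ≤ 2 * t ^ 2 / n := by
        simp_rw [mul_pow]
        rw [integral_const_mul, hu2]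
        have hk2 : ∫ ω, D ω ^ 2 ∂P ≤ k * s := hX.integral_inner_sq_le k
        refine (mul_le_mul_of_nonneg_left (hk2.trans
          (mul_le_mul_of_nonneg_right hkn hs.le)) (by positivity)).trans_eq ?_
        field_simp
      have h4 : ∫ ω, ((u * D ω) ^ 2) ^ 2 ∂P
          ≤ 4 * t ^ 4 * (3 * C ^ 2 * (L / n) + (L / n) ^ 2) / s ^ 2 / n := by
        have hrew : ∀ ω, ((u * D ω) ^ 2) ^ 2 = (u ^ 2) ^ 2 * D ω ^ 4 := fun ω => by ring
        simp_rw [hrew]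
        rw [integral_const_mul, hu2]
        have h5 : 3 * (k : ℝ) ^ 2 * (C ^ 2 * L) + k * L ^ 2
            ≤ 3 * (n : ℝ) ^ 2 * (C ^ 2 * L) + n * L ^ 2 := by gcongr
        refine (mul_le_mul_of_nonneg_left ((hX.integral_inner_pow_four_le hC k).trans h5)
          (by positivity)).trans_eq ?_
        field_simp
        ring
      calc 4 * ∫ ω, |u * D ω| ^ 3 ∂P = 4 * ∫ ω, |u * D ω * (u * D ω) ^ 2| ∂P := by
            simp_rw [habs]
        _ ≤ 4 * (√(2 * t ^ 2 / n)
            * √(4 * t ^ 4 * (3 * C ^ 2 * (L / n) + (L / n) ^ 2) / s ^ 2 / n)) := by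
            gcongr
            exact hcs.trans (mul_le_mul (Real.sqrt_le_sqrt h2) (Real.sqrt_le_sqrt h4)
              (Real.sqrt_nonneg _) (Real.sqrt_nonneg _))
        _ = ε₂ / n := by
            have h6 : 2 * t ^ 2 / n
                * (4 * t ^ 4 * (3 * C ^ 2 * (L / n) + (L / n) ^ 2) / s ^ 2 / n)
                = 8 * t ^ 6 * (3 * C ^ 2 * (L / n) + (L / n) ^ 2) / s ^ 2 / n ^ 2 := by
              field_simp
              ring
            rw [← Real.sqrt_mul (by positivity), h6, Real.sqrt_div' _ (sq_nonneg _),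
              Real.sqrt_sq hn0.le, hε₂]
            ring
  -- Each p_k is at most t²/n, so the n quadratic errors add up to t⁴/n.
  have hb := norm_sub_exp_neg_sum_le (q := t ^ 2 / n) (p := fun k => u ^ 2 * k * s / 2) (n := n)
    h0 hφ1 (fun k => by positivity)
    (fun k hk => by
      have hkn : (k : ℝ) ≤ n := by exact_mod_cast hk.le
      rw [hu2]
      calc 2 * t ^ 2 / (n ^ 2 * s) * k * s / 2 ≤ 2 * t ^ 2 / (n ^ 2 * s) * n * s / 2 := by gcongr
        _ = t ^ 2 / n := by field_simp) hstep
  have hsum : ∑ k ∈ Finset.range n, u ^ 2 * (k : ℝ) * s / 2 = t ^ 2 / 2 * (1 - (n : ℝ)⁻¹) := by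
    have hg : ∑ k ∈ Finset.range n, (k : ℝ) = n * (n - 1) / 2 := by
      clear * -
      induction n with
      | zero => simp
      | succ n ih => rw [Finset.sum_range_succ, ih]; push_cast; ring
    rw [← Finset.sum_div, ← Finset.sum_mul, ← Finset.mul_sum, hg, hu2]
    field_simp
  rw [hsum] at hb
  have hφn : φ n = ∫ ω, Complex.exp ((t * (√2 / (n * √s) * offDiagSum (.id ℝ V) (X · ω) n) : ℝ)
      * Complex.I) ∂P := by
    simp only [hφ, hu, mul_assoc]
  rw [← hφn]
  refine hb.trans_eq ?_
  field_simp

end IsCentredSample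

end NPIV

/-! ### The remainder in the expansion of the quadratic form. -/

namespace NPIV

set_option linter.unusedSectionVars false

variable {Ω : Type*} [MeasurableSpace Ω] {P : Measure Ω} [IsProbabilityMeasure P]

lemma tendstoInMeasure_of_tendsto_integral_abs {f : ℕ → Ω → ℝ} {g : Ω → ℝ}
    (hf : ∀ n, Integrable (fun ω => f n ω - g ω) P)
    (h : Tendsto (fun n => ∫ ω, |f n ω - g ω| ∂P) atTop (𝓝 0)) : TendstoInMeasure P f atTop g := by
  intro ε hε
  by_cases hε' : ε = ⊤
  · simp only [hε', top_le_iff]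
    simp
  have hle : ∀ n, P {x | ε ≤ edist (f n x) (g x)}
      ≤ ENNReal.ofReal (∫ ω, |f n ω - g ω| ∂P) / ε := fun n => by
    have h1 : ENNReal.ofReal (∫ ω, |f n ω - g ω| ∂P) = ∫⁻ ω, edist (f n ω) (g ω) ∂P := by
      rw [ofReal_integral_eq_lintegral_ofReal (hf n).abs (.of_forall fun ω => abs_nonneg _)]
      refine lintegral_congr fun ω => ?_
      rw [edist_dist, Real.dist_eq]
    rw [h1]
    have hm : AEMeasurable (fun ω => edist (f n ω) (g ω)) P := by
      have : (fun ω => edist (f n ω) (g ω)) = fun ω => ‖f n ω - g ω‖ₑ := by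
        funext ω; rw [edist_eq_enorm_sub]
      rw [this]
      exact (hf n).1.enorm
    exact meas_ge_le_lintegral_div hm hε.ne' hε'
  refine tendsto_of_tendsto_of_tendsto_of_le_of_le tendsto_const_nhds ?_ (fun _ => bot_le) hle
  have h2 := ENNReal.Tendsto.div_const (ENNReal.tendsto_ofReal h) (b := ε) (Or.inr hε.ne')
  simpa using h2

section Remainder

variable {V : Type*} [NormedAddCommGroup V] [InnerProductSpace ℝ V] [FiniteDimensional ℝ V]
  [MeasurableSpace V] [BorelSpace V] {Q : Measure V} {X : ℕ → Ω → V}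

lemma integral_norm_sub_sq_le {G : Ω → V} (hG : MemLp G 2 P) {d : V} (hd : ∫ ω, G ω ∂P = d) :
    ∫ ω, ‖G ω - d‖ ^ 2 ∂P ≤ ∫ ω, ‖G ω‖ ^ 2 ∂P := by
  have h1 : ∀ ω, ‖G ω - d‖ ^ 2 = ‖G ω‖ ^ 2 - 2 * ⟪d, G ω⟫ + ‖d‖ ^ 2 := fun ω => by
    rw [norm_sub_sq_real, real_inner_comm]
  have i1 : Integrable (fun ω => ‖G ω‖ ^ 2) P := hG.integrable_norm_pow_of_le (q := 2) le_rfl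
  have i2 : Integrable (fun ω => 2 * ⟪d, G ω⟫) P :=
    ((hG.integrable (by norm_num)).const_inner d).const_mul 2
  simp_rw [h1]
  rw [integral_add (i1.sub' i2) (integrable_const _), integral_sub i1 i2, integral_const_mul,
    integral_inner (hG.integrable (by norm_num)), hd, real_inner_self_eq_norm_sq]
  simp only [integral_const, probReal_univ, one_smul]
  nlinarith [sq_nonneg ‖d‖]

/-- The remainder in the expansion of `‖∑ (X_i + c G_i)‖² / n` around its degenerate quadratic part
and the deterministic drift. -/
noncomputable def quadRemainder (Q : Measure V) (d : V) (c : ℝ) (n : ℕ) (x g : ℕ → V) : ℝ :=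
  (partialSum (fun i => ‖x i‖ ^ 2 - ∫ y, ‖y‖ ^ 2 ∂Q) n) / n
    + 2 * c * ⟪d, partialSum x n⟫
    + 2 * c / n * ⟪partialSum x n, partialSum (fun i => g i - d) n⟫
    + 2 * c ^ 2 * ⟪d, partialSum (fun i => g i - d) n⟫
    + c ^ 2 / n * ‖partialSum (fun i => g i - d) n‖ ^ 2

/-- Expand ‖S + c(nd + E)‖² with S = ∑ x_i and E = ∑ (g_i - d). Of ‖S‖² only the off-diagonal part
stays in view, and c²n‖d‖² is the drift; an exact identity. -/
lemma norm_sq_div_sub_eq (Q : Measure V) (d : V) (c : ℝ) {n : ℕ} (hn : n ≠ 0) (x g : ℕ → V) :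
    ‖partialSum (fun i => x i + c • g i) n‖ ^ 2 / n - ∫ y, ‖y‖ ^ 2 ∂Q
      = 2 / n * offDiagSum (.id ℝ V) x n + c ^ 2 * n * ‖d‖ ^ 2 + quadRemainder Q d c n x g := by
  have hn0 : (n : ℝ) ≠ 0 := by exact_mod_cast hn
  have h1 : partialSum (fun i => x i + c • g i) n
      = partialSum x n + c • ((n : ℝ) • d + partialSum (fun i => g i - d) n) := by
    simp [partialSum, Finset.sum_add_distrib, Finset.smul_sum, Finset.sum_sub_distrib,
      Nat.cast_smul_eq_nsmul]
  have h2 : partialSum (fun i => ‖x i‖ ^ 2 - ∫ y, ‖y‖ ^ 2 ∂Q) n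
      = ‖partialSum x n‖ ^ 2 - 2 * offDiagSum (.id ℝ V) x n - n * ∫ y, ‖y‖ ^ 2 ∂Q := by
    rw [norm_partialSum_sq]
    simp [partialSum, Finset.sum_sub_distrib]
  rw [h1, quadRemainder, h2, norm_add_sq_real, norm_smul, mul_pow, norm_add_sq_real,
    inner_smul_right, inner_add_right, inner_smul_right, inner_smul_left, norm_smul, mul_pow]
  simp only [Real.norm_eq_abs, sq_abs, conj_trivial]
  rw [real_inner_comm d (partialSum x n)]
  field_simp
  ring

namespace IsCentredSample

variable (hX : IsCentredSample P Q X)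

include hX

lemma integral_abs_normSq_sum_le (n : ℕ) :
    Integrable (fun ω => partialSum (fun i => ‖X i ω‖ ^ 2 - ∫ y, ‖y‖ ^ 2 ∂Q) n) P ∧
    ∫ ω, |partialSum (fun i => ‖X i ω‖ ^ 2 - ∫ y, ‖y‖ ^ 2 ∂Q) n| ∂P
      ≤ √(n * fourthMoment Q) := by
  have := hX.isProbabilityMeasure
  set μ := ∫ y, ‖y‖ ^ 2 ∂Q
  have hsqL : ∀ i, MemLp (fun ω => ‖X i ω‖ ^ 2) 2 P := fun i => by
    have h := (hX.memLp i).integrable_norm_pow_of_le (p := 4) (q := 4) le_rfl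
    exact (memLp_two_iff_integrable_sq
      ((hX.measurable i).norm.pow_const 2).aestronglyMeasurable).2 (h.congr (.of_forall fun ω => by ring))
  have hmean : ∀ i, ∫ ω, ‖X i ω‖ ^ 2 ∂P = μ := fun i =>
    hX.integral_comp (g := fun x => ‖x‖ ^ 2) (by fun_prop) i
  have hL : ∀ i, MemLp (fun ω => ‖X i ω‖ ^ 2 - μ) 2 P := fun i => (hsqL i).sub (memLp_const μ)
  have hb := integral_norm_partialSum_sq_le (X := fun i ω => ‖X i ω‖ ^ 2 - μ)
    (fun i => ((hX.measurable i).norm.pow_const 2).sub_const μ)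
    (hX.indep_real (g := fun x => ‖x‖ ^ 2 - μ) (by fun_prop)) hL
    (fun i => by
      rw [integral_sub ((hsqL i).integrable (by norm_num)) (integrable_const _), hmean]
      simp)
    (b := fourthMoment Q)
    (fun i => by
      refine (integral_norm_sub_sq_le (hsqL i) (hmean i)).trans_eq ?_
      rw [fourthMoment, ← hX.integral_comp (g := fun x => ‖x‖ ^ 4) (by fun_prop) i]
      refine integral_congr_ae (.of_forall fun ω => ?_)
      simp only [Real.norm_eq_abs, abs_pow, abs_norm]
      ring) n
  have hL' := NPIV.memLp_partialSum hL n
  refine ⟨hL'.integrable (by norm_num), (integral_abs_le_sqrt hL').trans (Real.sqrt_le_sqrt ?_)⟩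
  simpa using hb

lemma integral_norm_partialSum_sq_le' (n : ℕ) :
    ∫ ω, ‖partialSum (X · ω) n‖ ^ 2 ∂P ≤ n * √(fourthMoment Q) := by
  have := hX.isProbabilityMeasure
  refine integral_norm_partialSum_sq_le hX.measurable hX.indep
    (fun i => memLp_two_of_four (hX.memLp i)) hX.integral_eq_zero (fun i => ?_) n
  have hsqL : MemLp (fun x : V => ‖x‖ ^ 2) 2 Q := by
    have h := hX.memLp_id.integrable_norm_pow_of_le (p := 4) (q := 4) le_rfl
    exact (memLp_two_iff_integrable_sq (by fun_prop)).2
      (h.congr (.of_forall fun x => by simp only [id]; ring))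
  rw [hX.integral_comp (g := fun x => ‖x‖ ^ 2) (by fun_prop) i]
  have h := integral_abs_le_sqrt hsqL
  simp only [abs_pow, abs_norm, ← pow_mul] at h
  exact h

/-- The summands are bounded one by one, in the order of `quadRemainder`. X_i and G_i may be
dependent, so the mixed term ⟪S, E⟫ is handled by Cauchy–Schwarz; ⟪d, S⟫ is handled through C, which
avoids any loss growing with the dimension. -/
theorem integral_abs_quadRemainder_le {C : ℝ}
    (hC : ∀ x, ⟪covarianceOperator Q x, x⟫ ≤ C * ‖x‖ ^ 2)
    {G : ℕ → Ω → V} (hGm : ∀ i, Measurable (G i)) (hGi : iIndepFun G P)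
    (hGL : ∀ i, MemLp (G i) 2 P) {d : V} (hGd : ∀ i, ∫ ω, G i ω ∂P = d) {B : ℝ}
    (hGB : ∀ i, ∫ ω, ‖G i ω‖ ^ 2 ∂P ≤ B) {c : ℝ} (hc : 0 ≤ c) (n : ℕ) :
    Integrable (fun ω => quadRemainder Q d c n (X · ω) (G · ω)) P ∧
    ∫ ω, |quadRemainder Q d c n (X · ω) (G · ω)| ∂P
      ≤ √(n * fourthMoment Q) / n + 2 * c * √(n * (C * ‖d‖ ^ 2))
        + 2 * c / n * (√(n * √(fourthMoment Q)) * √(n * B))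
        + 2 * c ^ 2 * (‖d‖ * √(n * B)) + c ^ 2 / n * (n * B) := by
  have := hX.isProbabilityMeasure
  set S : Ω → V := fun ω => partialSum (X · ω) n
  set E : Ω → V := fun ω => partialSum (fun i => G i ω - d) n
  have hSL : MemLp S 2 P := memLp_two_of_four (hX.memLp_partialSum n)
  have hEL : MemLp E 2 P := 
    NPIV.memLp_partialSum (X := fun i ω => G i ω - d) (fun i => (hGL i).sub (memLp_const d)) n
  have hE2 : ∫ ω, ‖E ω‖ ^ 2 ∂P ≤ n * B :=
    integral_norm_partialSum_sq_le (X := fun i ω => G i ω - d)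
      (fun i => (hGm i).sub_const d) (hGi.comp (fun _ x => x - d) fun _ => by fun_prop)
      (fun i => (hGL i).sub (memLp_const d))
      (fun i => by
        rw [integral_sub ((hGL i).integrable (by norm_num)) (integrable_const _), hGd]
        simp)
      (fun i => (integral_norm_sub_sq_le (hGL i) (hGd i)).trans (hGB i)) n
  obtain ⟨i1, b1⟩ := hX.integral_abs_normSq_sum_le n
  set T : Ω → ℝ := fun ω => partialSum (fun i => ‖X i ω‖ ^ 2 - ∫ y, ‖y‖ ^ 2 ∂Q) n
  have m2 : MemLp (fun ω => ⟪d, S ω⟫) 2 P := hSL.const_inner d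
  have i2 : Integrable (fun ω => ⟪d, S ω⟫) P := m2.integrable (by norm_num)
  have b2 : ∫ ω, |⟪d, S ω⟫| ∂P ≤ √(n * (C * ‖d‖ ^ 2)) := by
    refine (integral_abs_le_sqrt m2).trans (Real.sqrt_le_sqrt ?_)
    exact (hX.integral_inner_partialSum_sq_le d n).trans (by gcongr; exact hC d)
  have i3 : Integrable (fun ω => ⟪S ω, E ω⟫) P := memLp_two_integrable_inner hSL hEL
  have b3 : ∫ ω, |⟪S ω, E ω⟫| ∂P ≤ √(n * √(fourthMoment Q)) * √(n * B) := by
    calc _ ≤ ∫ ω, ‖S ω‖ * ‖E ω‖ ∂P := integral_mono i3.abs (hSL.norm.integrable_mul hEL.norm)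
            fun ω => abs_real_inner_le_norm _ _
      _ ≤ _ := integral_norm_mul_norm_le_sqrt hSL hEL
      _ ≤ _ := by
        gcongr
        exact hX.integral_norm_partialSum_sq_le' n
  have i4 : Integrable (fun ω => ⟪d, E ω⟫) P := (hEL.integrable (by norm_num)).const_inner d
  have b4 : ∫ ω, |⟪d, E ω⟫| ∂P ≤ ‖d‖ * √(n * B) := by
    calc _ ≤ ∫ ω, ‖d‖ * |‖E ω‖| ∂P := integral_mono i4.abs
            ((hEL.integrable (by norm_num)).norm.abs.const_mul _)
            fun ω => by simpa using abs_real_inner_le_norm d (E ω)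
      _ = ‖d‖ * ∫ ω, |‖E ω‖| ∂P := integral_const_mul _ _
      _ ≤ _ := by
        gcongr
        exact (integral_abs_le_sqrt hEL.norm).trans (Real.sqrt_le_sqrt hE2)
  have i5 : Integrable (fun ω => ‖E ω‖ ^ 2) P := hEL.integrable_norm_pow_of_le (q := 2) le_rfl
  have j1 := i1.div_const n
  have j2 := i2.const_mul (2 * c)
  have j3 := i3.const_mul (2 * c / n)
  have j4 := i4.const_mul (2 * c ^ 2)
  have j5 := i5.const_mul (c ^ 2 / n)
  have k1 := i1.abs.div_const n
  have k2 := i2.abs.const_mul (2 * c)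
  have k3 := i3.abs.const_mul (2 * c / n)
  have k4 := i4.abs.const_mul (2 * c ^ 2)
  refine ⟨(((j1.fun_add j2).fun_add j3).fun_add j4).fun_add j5, ?_⟩
  calc _ ≤ ∫ ω, (|T ω| / n + 2 * c * |⟪d, S ω⟫| + 2 * c / n * |⟪S ω, E ω⟫|
          + 2 * c ^ 2 * |⟪d, E ω⟫| + c ^ 2 / n * ‖E ω‖ ^ 2) ∂P := by
        refine integral_mono_of_nonneg (.of_forall fun ω => abs_nonneg _)
          ((((k1.fun_add k2).fun_add k3).fun_add k4).fun_add j5) (.of_forall fun ω => ?_)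
        have h1 : |T ω / n| = |T ω| / n := by rw [abs_div, Nat.abs_cast]
        have h2 : |2 * c * ⟪d, S ω⟫| = 2 * c * |⟪d, S ω⟫| := by
          rw [abs_mul, abs_of_nonneg (by positivity)]
        have h3 : |2 * c / n * ⟪S ω, E ω⟫| = 2 * c / n * |⟪S ω, E ω⟫| := by
          rw [abs_mul, abs_of_nonneg (by positivity)]
        have h4 : |2 * c ^ 2 * ⟪d, E ω⟫| = 2 * c ^ 2 * |⟪d, E ω⟫| := by
          rw [abs_mul, abs_of_nonneg (by positivity)]
        have h5 : |c ^ 2 / n * ‖E ω‖ ^ 2| = c ^ 2 / n * ‖E ω‖ ^ 2 := abs_of_nonneg (by positivity)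
        change |T ω / n + 2 * c * ⟪d, S ω⟫ + 2 * c / n * ⟪S ω, E ω⟫ + 2 * c ^ 2 * ⟪d, E ω⟫
          + c ^ 2 / n * ‖E ω‖ ^ 2| ≤ |T ω| / n + 2 * c * |⟪d, S ω⟫| + 2 * c / n * |⟪S ω, E ω⟫|
          + 2 * c ^ 2 * |⟪d, E ω⟫| + c ^ 2 / n * ‖E ω‖ ^ 2
        refine (abs_add_le _ _).trans ((add_le_add_left ((abs_add_le _ _).trans
          (add_le_add_left (abs_add_three _ _ _) _)) _).trans_eq ?_)
        rw [h1, h2, h3, h4, h5]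
    _ = (∫ ω, |T ω| ∂P) / n + 2 * c * ∫ ω, |⟪d, S ω⟫| ∂P + 2 * c / n * ∫ ω, |⟪S ω, E ω⟫| ∂P
          + 2 * c ^ 2 * ∫ ω, |⟪d, E ω⟫| ∂P + c ^ 2 / n * ∫ ω, ‖E ω‖ ^ 2 ∂P := by
        rw [integral_add (((k1.fun_add k2).fun_add k3).fun_add k4) j5,
          integral_add ((k1.fun_add k2).fun_add k3) k4, integral_add (k1.fun_add k2) k3,
          integral_add k1 k2, integral_div]
        simp only [integral_const_mul]
    _ ≤ _ := by gcongr

end IsCentredSample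

end Remainder

end NPIV

/-! ### Limit theorems for triangular arrays in varying dimension. -/

namespace NPIV

set_option linter.unusedSectionVars false

variable {Ω : Type*} [MeasurableSpace Ω] {P : Measure Ω} [IsProbabilityMeasure P]

/-- The decomposition divides by n and by ς, so it is available only for large n; convergence in law
ignores the other indices and sees only the law of the limit variable. -/
lemma tendstoInDistribution_id_of_eventually_eq {Ω' : Type*} [MeasurableSpace Ω'] {μ' : Measure Ω'}
    [IsProbabilityMeasure μ'] {μ : Measure ℝ} [IsProbabilityMeasure μ] {X Y : ℕ → Ω → ℝ}
    {Z : Ω' → ℝ} (h : TendstoInDistribution X atTop Z (fun _ => P) μ') (hZ : μ'.map Z = μ)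
    (hY : ∀ n, AEMeasurable (Y n) P) (hXY : ∀ᶠ n in atTop, X n =ᵐ[P] Y n) :
    TendstoInDistribution Y atTop (id : ℝ → ℝ) (fun _ => P) μ where
  forall_aemeasurable := hY
  tendsto := by
    have hlim : (⟨μ'.map Z, Measure.isProbabilityMeasure_map h.aemeasurable_limit⟩ :
        ProbabilityMeasure ℝ) = ⟨μ.map id, Measure.isProbabilityMeasure_map aemeasurable_id⟩ :=
      Subtype.ext (hZ.trans Measure.map_id.symm)
    rw [← hlim]
    refine h.tendsto.congr' ?_
    filter_upwards [hXY] with n hn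
    exact Subtype.ext (Measure.map_congr hn)

variable
  {V : ℕ → Type*} [∀ n, NormedAddCommGroup (V n)] [∀ n, InnerProductSpace ℝ (V n)]
  [∀ n, FiniteDimensional ℝ (V n)] [∀ n, MeasurableSpace (V n)] [∀ n, BorelSpace (V n)]
  {Q : ∀ n, Measure (V n)} {X : ∀ n, ℕ → Ω → V n}

/-- Central limit theorem for triangular arrays of degenerate `U`-statistics
`∑_{i < j < n} ⟪X_i, X_j⟫`, whose covariance operators are bounded with Hilbert–Schmidt norms
tending to infinity. -/
theorem tendstoInDistribution_offDiagSum (hX : ∀ n, IsCentredSample P (Q n) (X n)) {C : ℝ}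
    (hC0 : 0 ≤ C) (hC : ∀ n, ∀ x, ⟪covarianceOperator (Q n) x, x⟫ ≤ C * ‖x‖ ^ 2)
    (hs : Tendsto (fun n => √(covNormSq (Q n))) atTop atTop)
    (hL : Tendsto (fun n => fourthMoment (Q n) / n) atTop (𝓝 0)) :
    TendstoInDistribution
      (fun (n : ℕ) ω => √2 / (n * √(covNormSq (Q n))) * offDiagSum (.id ℝ (V n)) (X n · ω) n)
      atTop (id : ℝ → ℝ) (fun _ => P) (gaussianReal 0 1) where
  forall_aemeasurable n := ((measurable_offDiagSum _ (hX n).measurable n).const_mul _).aemeasurable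
  tendsto := by
    refine ProbabilityMeasure.tendsto_iff_tendsto_charFun.2 fun t => ?_
    simp only [ProbabilityMeasure.coe_mk, Measure.map_id, charFun_gaussianReal]
    have hinv : Tendsto (fun n => (√(covNormSq (Q n)))⁻¹) atTop (𝓝 0) := hs.inv_tendsto_atTop
    have hinv2 : Tendsto (fun n => (covNormSq (Q n))⁻¹) atTop (𝓝 0) := by
      have h := hinv.pow 2
      simp only [ne_eq, OfNat.ofNat_ne_zero, not_false_eq_true, zero_pow] at h
      refine h.congr fun n => ?_
      have := (hX n).isProbabilityMeasure
      rw [inv_pow, Real.sq_sqrt covNormSq_nonneg]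
    have hninv : Tendsto (fun n : ℕ => (n : ℝ)⁻¹) atTop (𝓝 0) := tendsto_inv_atTop_nhds_zero_nat
    -- Every summand carries a positive power of `fourthMoment (Q n) / n`, of 1/√`covNormSq (Q n)`
    -- or of 1/n.
    have hbound : Tendsto (fun n : ℕ =>
        t ^ 2 * (C * √(fourthMoment (Q n) / n) / covNormSq (Q n) + 2 * C / √(covNormSq (Q n)))
        + 4 * √(8 * t ^ 6 * (3 * C ^ 2 * (fourthMoment (Q n) / n) + (fourthMoment (Q n) / n) ^ 2)
            / covNormSq (Q n) ^ 2) + t ^ 4 / n) atTop (𝓝 0) := by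
      simp only [div_eq_mul_inv, ← inv_pow] at hL ⊢
      have h := ((((hL.sqrt.const_mul C).mul hinv2).add (hinv.const_mul (2 * C))).const_mul
        (t ^ 2)).add ((((((hL.const_mul (3 * C ^ 2)).add (hL.pow 2)).const_mul (8 * t ^ 6)).mul
          (hinv2.pow 2)).sqrt).const_mul 4) |>.add (hninv.const_mul (t ^ 4))
      simpa using h
    have hexp : Tendsto (fun n : ℕ => ((Real.exp (-(t ^ 2 / 2 * (1 - (n : ℝ)⁻¹))) : ℝ) : ℂ)) atTop
        (𝓝 ((Real.exp (-(t ^ 2 / 2 * (1 - 0))) : ℝ) : ℂ)) :=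
      (Complex.continuous_ofReal.tendsto _).comp ((Real.continuous_exp.tendsto _).comp
        ((hninv.const_sub 1).const_mul _).neg)
    have hdiff : Tendsto (fun n : ℕ => charFun (P.map fun ω =>
        √2 / (n * √(covNormSq (Q n))) * offDiagSum (.id ℝ (V n)) (X n · ω) n) t
        - ((Real.exp (-(t ^ 2 / 2 * (1 - (n : ℝ)⁻¹))) : ℝ) : ℂ)) atTop (𝓝 0) := by
      refine squeeze_zero_norm' ?_ hbound
      filter_upwards [eventually_ne_atTop 0, hs.eventually_gt_atTop 0] with n hn hsn
      rw [charFun_apply_real, integral_map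
        ((measurable_offDiagSum _ (hX n).measurable n).const_mul _).aemeasurable (by fun_prop)]
      have h := (hX n).norm_charFun_offDiagSum_sub_le hC0 (hC n) (Real.sqrt_pos.1 hsn) hn t
      simpa only [Complex.ofReal_mul] using h
    have h := hdiff.add hexp
    simp only [sub_add_cancel, zero_add] at h
    convert h using 2
    push_cast
    simp

/-- Central limit theorem for quadratic forms `‖∑ (X_i + c_n G_i)‖² / n` in triangular arrays, where
`c_n = (ς_n / n)^{1/2}` and `ς_n` is the Hilbert–Schmidt norm of the covariance operator. -/
theorem tendstoInDistribution_normSq (hX : ∀ n, IsCentredSample P (Q n) (X n)) {C : ℝ}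
    (hC0 : 0 ≤ C) (hC : ∀ n, ∀ x, ⟪covarianceOperator (Q n) x, x⟫ ≤ C * ‖x‖ ^ 2)
    (hs : Tendsto (fun n => √(covNormSq (Q n))) atTop atTop)
    {G : ∀ n, ℕ → Ω → V n} (hGm : ∀ n i, Measurable (G n i)) (hGi : ∀ n, iIndepFun (G n) P)
    (hGL : ∀ n i, MemLp (G n i) 2 P) {d : ∀ n, V n} (hGd : ∀ n i, ∫ ω, G n i ω ∂P = d n)
    {ρ : ℕ → ℝ} (hρ0 : ∀ n, 0 ≤ ρ n) (hρ : Tendsto (fun n => ρ n ^ 2 / n) atTop (𝓝 0)) {K : ℝ}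
    (hL : ∀ n, fourthMoment (Q n) ≤ K ^ 2 * ρ n ^ 2) (hK : 0 ≤ K)
    (hGB : ∀ n i, ∫ ω, ‖G n i ω‖ ^ 2 ∂P ≤ K * ρ n)
    {D : ℝ} (hD : Tendsto (fun n => ‖d n‖ ^ 2) atTop (𝓝 D)) :
    TendstoInDistribution
      (fun (n : ℕ) ω => (√2 * √(covNormSq (Q n)))⁻¹ *
        (‖partialSum (fun i => X n i ω + (√√(covNormSq (Q n)) / √n) • G n i ω) n‖ ^ 2 / n
          - ∫ x, ‖x‖ ^ 2 ∂(Q n)))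
      atTop (id : ℝ → ℝ) (fun _ => P) (gaussianReal ((√2)⁻¹ * D) 1) := by
  set v : ℕ → ℝ := fun n => √(covNormSq (Q n)) with hv
  set c : ℕ → ℝ := fun n => √(v n) / √n with hc
  have hv0 : ∀ n, 0 ≤ v n := fun n => Real.sqrt_nonneg _
  have hc2 : ∀ n, c n ^ 2 = v n / n := fun n => by
    rw [hc, div_pow, Real.sq_sqrt (hv0 n), Real.sq_sqrt (Nat.cast_nonneg n)]
  have hL4 : Tendsto (fun n => fourthMoment (Q n) / n) atTop (𝓝 0) := by
    have h := hρ.const_mul (K ^ 2)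
    rw [mul_zero] at h
    refine squeeze_zero (fun n => ?_) (fun n => ?_) h
    · have := (hX n).isProbabilityMeasure
      exact div_nonneg fourthMoment_nonneg (Nat.cast_nonneg n)
    · rw [← mul_div_assoc]
      exact div_le_div_of_nonneg_right (hL n) (Nat.cast_nonneg n)
  have hclt := tendstoInDistribution_offDiagSum hX hC0 hC hs hL4
  set R : ℕ → Ω → ℝ := fun n ω => quadRemainder (Q n) (d n) (c n) n (X n · ω) (G n · ω) with hR
  have hRem : ∀ n, Integrable (R n) P ∧ ∫ ω, |R n ω| ∂P ≤ _ := fun n =>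
    (hX n).integral_abs_quadRemainder_le (hC n) (hGm n) (hGi n) (hGL n) (hGd n) (hGB n)
      (show 0 ≤ c n by positivity) n
  -- Everything except the U-statistic: normalised drift plus normalised remainder, to be shown to
  -- converge in probability to a constant.
  set Y : ℕ → Ω → ℝ := fun n ω => (√2)⁻¹ * ‖d n‖ ^ 2 + (√2 * v n)⁻¹ * R n ω with hY
  have hvinv : Tendsto (fun n => (v n)⁻¹) atTop (𝓝 0) := hs.inv_tendsto_atTop
  have hρ1 : Tendsto (fun n => ρ n / n) atTop (𝓝 0) := by
    have h := hρ.add (tendsto_inv_atTop_nhds_zero_nat (𝕜 := ℝ))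
    rw [add_zero] at h
    refine squeeze_zero (fun n => div_nonneg (hρ0 n) (Nat.cast_nonneg n)) (fun n => ?_) h
    rw [← one_div, ← add_div]
    refine div_le_div_of_nonneg_right ?_ (Nat.cast_nonneg n)
    nlinarith [sq_nonneg (ρ n - 1)]
  have hdn : Tendsto (fun n => ‖d n‖) atTop (𝓝 √D) := by
    refine hD.sqrt.congr fun n => Real.sqrt_sq (norm_nonneg _)
  have hRlim : Tendsto (fun n => (v n)⁻¹ * ∫ ω, |R n ω| ∂P) atTop (𝓝 0) := by
    -- These are the five remainder bounds divided by v, after inserting c = √(v/n).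
    have hlim : Tendsto (fun n => (v n)⁻¹ * (K * √(ρ n ^ 2 / n))
        + 2 * √C * (‖d n‖ * √((v n)⁻¹)) + 2 * K * (√(ρ n ^ 2 / n) * √((v n)⁻¹))
        + 2 * (‖d n‖ * √(K * (ρ n / n))) + K * (ρ n / n)) atTop (𝓝 0) := by
      have h := ((((hvinv.mul (hρ.sqrt.const_mul K)).add
        ((hdn.mul hvinv.sqrt).const_mul (2 * √C))).add
        ((hρ.sqrt.mul hvinv.sqrt).const_mul (2 * K))).add
        ((hdn.mul (hρ1.const_mul K).sqrt).const_mul 2)).add (hρ1.const_mul K)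
      simpa using h
    refine squeeze_zero' (.of_forall fun n => mul_nonneg (inv_nonneg.2 (hv0 n))
      (integral_nonneg fun ω => abs_nonneg _)) ?_ hlim
    filter_upwards [eventually_ne_atTop 0, hs.eventually_gt_atTop 0] with n hn hvn
    have hn0 : (0 : ℝ) < n := by positivity
    change 0 < v n at hvn
    have hsn : √(n : ℝ) ^ 2 = n := Real.sq_sqrt hn0.le
    have hsv : √(v n) ^ 2 = v n := Real.sq_sqrt hvn.le
    have hsn0 : 0 < √(n : ℝ) := Real.sqrt_pos.2 hn0
    have hsv0 : 0 < √(v n) := Real.sqrt_pos.2 hvn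
    have hρn := hρ0 n
    have hL2 : √(fourthMoment (Q n)) ≤ K * ρ n := by
      rw [← Real.sqrt_sq (mul_nonneg hK hρn), mul_pow]
      exact Real.sqrt_le_sqrt (hL n)
    have e1 : √(n * fourthMoment (Q n)) ≤ √n * (K * ρ n) := by
      rw [Real.sqrt_mul hn0.le]; gcongr
    have e2 : √(n * (C * ‖d n‖ ^ 2)) = √n * (√C * ‖d n‖) := by
      rw [Real.sqrt_mul hn0.le, Real.sqrt_mul hC0, Real.sqrt_sq (norm_nonneg _)]
    have e3 : √(n * √(fourthMoment (Q n))) * √(n * (K * ρ n)) ≤ n * (K * ρ n) := by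
      calc _ ≤ √(n * (K * ρ n)) * √(n * (K * ρ n)) := by gcongr
        _ = _ := Real.mul_self_sqrt (by positivity)
    have e4 : √(n * (K * ρ n)) = n * √(K * (ρ n / n)) := by
      rw [show n * (K * ρ n) = (n : ℝ) ^ 2 * (K * (ρ n / n)) by field_simp,
        Real.sqrt_mul (sq_nonneg _), Real.sqrt_sq hn0.le]
    have e5 : √(ρ n ^ 2 / n) = ρ n / √n := by
      rw [Real.sqrt_div' _ hn0.le, Real.sqrt_sq hρn]
    have e6 : √((v n)⁻¹) = (√(v n))⁻¹ := Real.sqrt_inv _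
    have hcn : 0 ≤ c n := by positivity
    calc (v n)⁻¹ * ∫ ω, |R n ω| ∂P
        ≤ (v n)⁻¹ * (√n * (K * ρ n) / n + 2 * c n * (√n * (√C * ‖d n‖))
          + 2 * c n / n * (n * (K * ρ n)) + 2 * c n ^ 2 * (‖d n‖ * (n * √(K * (ρ n / n))))
          + c n ^ 2 / n * (n * (K * ρ n))) := by
          refine mul_le_mul_of_nonneg_left ((hRem n).2.trans ?_) (inv_nonneg.2 hvn.le)
          rw [← e2, ← e4]
          gcongr
      _ = _ := by
          rw [hc2, e5, e6]
          simp only [hc]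
          -- With the roots as atoms, and v = a², n = b², both sides are rational expressions.
          generalize √(K * (ρ n / n)) = q
          generalize √(v n) = a at *
          generalize √(n : ℝ) = b at *
          rw [← hsv, ← hsn]
          field_simp
  have hYint : ∀ n, Integrable (fun ω => Y n ω - (√2)⁻¹ * D) P := fun n =>
    ((integrable_const _).fun_add ((hRem n).1.const_mul _)).sub' (integrable_const _)
  have hYlim : TendstoInMeasure P Y atTop fun _ => (√2)⁻¹ * D := by
    refine tendstoInMeasure_of_tendsto_integral_abs hYint ?_
    have h := (((hD.sub_const D).abs.const_mul (√2)⁻¹)).add (hRlim.const_mul (√2)⁻¹)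
    rw [sub_self, abs_zero, mul_zero, add_zero] at h
    refine squeeze_zero (fun n => integral_nonneg fun ω => abs_nonneg _) (fun n => ?_) h
    have hi := ((hRem n).1.abs.const_mul (v n)⁻¹).const_mul (√2)⁻¹
    calc _ ≤ ∫ ω, ((√2)⁻¹ * |‖d n‖ ^ 2 - D| + (√2)⁻¹ * ((v n)⁻¹ * |R n ω|)) ∂P := by
          refine integral_mono (hYint n).abs ((integrable_const _).fun_add hi) fun ω => ?_
          have hrw : Y n ω - (√2)⁻¹ * D
              = (√2)⁻¹ * (‖d n‖ ^ 2 - D) + (√2)⁻¹ * ((v n)⁻¹ * R n ω) := by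
            simp only [hY, mul_inv]; ring
          rw [hrw]
          refine (abs_add_le _ _).trans_eq ?_
          rw [abs_mul, abs_mul, abs_mul, abs_of_nonneg (by positivity : (0 : ℝ) ≤ (√2)⁻¹),
            abs_of_nonneg (inv_nonneg.2 (hv0 n))]
      _ = _ := by
          rw [integral_add (integrable_const _) hi]
          simp only [integral_const_mul]
          simp
  -- Slutsky's theorem.
  have hsum := hclt.add_of_tendstoInMeasure_const hYlim fun n =>
    ((hYint n).1.aemeasurable.add_const ((√2)⁻¹ * D)).congr (.of_forall fun ω => by simp)
  refine tendstoInDistribution_id_of_eventually_eq hsum ?_ (fun n => ?_) ?_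
  · simpa using gaussianReal_map_add_const (μ := 0) (v := 1) ((√2)⁻¹ * D)
  · have hm : Measurable fun ω => partialSum (fun i => X n i ω + c n • G n i ω) n :=
      measurable_partialSum
        (fun i => ((hX n).measurable i).add ((hGm n i).const_smul (c n))) n
    exact ((((hm.norm.pow_const 2).div_const _).sub_const _).const_mul _).aemeasurable
  · filter_upwards [eventually_ne_atTop 0, hs.eventually_gt_atTop 0] with n hn hvn
    change 0 < v n at hvn
    refine .of_forall fun ω => ?_
    have hn0 : (n : ℝ) ≠ 0 := by exact_mod_cast hn
    have h2 : √(2 : ℝ) ^ 2 = 2 := Real.sq_sqrt (by norm_num)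
    have h20 : √(2 : ℝ) ≠ 0 := by positivity
    have hvn0 := hvn.ne'
    change √2 / (n * v n) * offDiagSum (.id ℝ (V n)) (X n · ω) n
      + ((√2)⁻¹ * ‖d n‖ ^ 2 + (√2 * v n)⁻¹ * R n ω) = (√2 * v n)⁻¹ * (_ - _)
    rw [norm_sq_div_sub_eq (Q n) (d n) (c n) hn, hc2]
    change _ = (√2 * v n)⁻¹ * (_ + R n ω)
    field_simp
    rw [h2]
    ring

end NPIV

/-! ### Domination of the law of W by the reference density, and Parseval. -/

namespace NPIV

variable {Ω : Type*} [MeasurableSpace Ω] {P : Measure Ω}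

lemma integrable_pow_four {g : Ω → ℝ} (hg : MemLp g 4 P) : Integrable (fun ω => g ω ^ 4) P :=
  (hg.integrable_norm_pow (p := 4) (by norm_num)).congr
    (.of_forall fun ω => Even.pow_abs (show Even 4 by decide) (g ω))

lemma memLp_two_sq {g : Ω → ℝ} (hg : MemLp g 4 P) : MemLp (fun ω => g ω ^ 2) 2 P :=
  (memLp_two_iff_integrable_sq (hg.1.pow 2)).2
    ((integrable_pow_four hg).congr (.of_forall fun ω => (pow_mul (g ω) 2 2)))

section Density

variable {k : ℕ} {W : Ω → Vec k} {U : Ω → ℝ} {pW ν : Vec k → ℝ}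

/-- The ratio bound is available only on the support, but the complement of the support is null for
the law of W, so every set may be intersected with it. -/
lemma map_le_smul_densMeasure (hν : IsProbDensity ν)
    (hWlaw : P.map W = densMeasure pW) {ηp : ℝ} (hη : 0 ≤ ηp)
    (h : ∀ w ∈ supp P W, 0 < ν w ∧ pW w / ν w ≤ ηp) :
    P.map W ≤ ENNReal.ofReal ηp • densMeasure ν := by
  have hsm : MeasurableSet (supp P W) := (Measure.isClosed_support (μ := P.map W)).measurableSet
  refine Measure.le_iff.2 fun s hs => ?_
  calc P.map W s = P.map W (s ∩ supp P W) := by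
        exact (measure_inter_conull Measure.measure_compl_support).symm
    _ = ∫⁻ w in s ∩ supp P W, ENNReal.ofReal (pW w) := by
        rw [hWlaw, densMeasure, withDensity_apply _ (hs.inter hsm)]
    _ ≤ ∫⁻ w in s ∩ supp P W, ENNReal.ofReal ηp * ENNReal.ofReal (ν w) := by
        refine setLIntegral_mono' (hs.inter hsm) fun w hw => ?_
        rw [← ENNReal.ofReal_mul hη]
        obtain ⟨h1, h2⟩ := h w hw.2
        exact ENNReal.ofReal_le_ofReal ((div_le_iff₀ h1).1 h2)
    _ ≤ ∫⁻ w in s, ENNReal.ofReal ηp * ENNReal.ofReal (ν w) :=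
        lintegral_mono_set Set.inter_subset_left
    _ = (ENNReal.ofReal ηp • densMeasure ν) s := by
        rw [lintegral_const_mul _ hν.measurable.ennreal_ofReal, Measure.smul_apply, densMeasure,
          withDensity_apply _ hs, smul_eq_mul]

/-- On an event {W ∈ s} the integrals of U⁴ and of E[U⁴ | W] agree, and the latter is at most σ⁴ P(W
∈ s). -/
lemma map_withDensity_pow_four_le [IsProbabilityMeasure P] (hW : Measurable W) (hU : MemLp U 4 P)
    {σ : ℝ} (hσ : ∀ᵐ ω ∂P, (P[fun ω => U ω ^ 4 | sigmaOf W]) ω ≤ σ ^ 4) :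
    (P.withDensity fun ω => ENNReal.ofReal (U ω ^ 4)).map W
      ≤ ENNReal.ofReal (σ ^ 4) • P.map W := by
  have hi := integrable_pow_four hU
  refine Measure.le_iff.2 fun s hs => ?_
  have hWs : MeasurableSet (W ⁻¹' s) := hW hs
  rw [Measure.map_apply hW hs, withDensity_apply _ hWs, Measure.smul_apply, smul_eq_mul,
    Measure.map_apply hW hs,
    ← ofReal_integral_eq_lintegral_ofReal hi.integrableOn (.of_forall fun ω => by positivity),
    ← setIntegral_condExp hW.comap_le hi ⟨s, hs, rfl⟩, ← ofReal_measureReal,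
    ← ENNReal.ofReal_mul (by positivity)]
  refine ENNReal.ofReal_le_ofReal ?_
  calc _ ≤ ∫ ω in W ⁻¹' s, σ ^ 4 ∂P :=
        setIntegral_mono_ae integrable_condExp.integrableOn (integrable_const _).integrableOn hσ
    _ = _ := by simp [mul_comm]

/-- Moments of functions of `W`, possibly weighted by `U⁴`, are dominated by integrals against the
reference density. -/
structure DominatedMoments (P : Measure Ω) (W : Ω → Vec k) (U : Ω → ℝ) (ν : Vec k → ℝ)
    (a b : ℝ) : Prop where
  lintegral_le : ∀ h : Vec k → ENNReal, Measurable h →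
    ∫⁻ ω, h (W ω) ∂P ≤ ENNReal.ofReal a * ∫⁻ s, h s ∂(densMeasure ν)
  lintegral_pow_four_le : ∀ h : Vec k → ENNReal, Measurable h →
    ∫⁻ ω, ENNReal.ofReal (U ω ^ 4) * h (W ω) ∂P
      ≤ ENNReal.ofReal b * ∫⁻ s, h s ∂(densMeasure ν)

lemma dominatedMoments [IsProbabilityMeasure P] (hW : Measurable W) (hUm : Measurable U)
    (hν : IsProbDensity ν) (hWlaw : P.map W = densMeasure pW) {ηp : ℝ} (hη : 0 ≤ ηp) (h : ∀ w ∈ supp P W, 0 < ν w ∧ pW w / ν w ≤ ηp) (hU : MemLp U 4 P)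
    {σ : ℝ} (hσ : ∀ᵐ ω ∂P, (P[fun ω => U ω ^ 4 | sigmaOf W]) ω ≤ σ ^ 4) :
    DominatedMoments P W U ν ηp (σ ^ 4 * ηp) := by
  have h1 := map_le_smul_densMeasure hν hWlaw hη h
  have h0 : ∀ g : Vec k → ENNReal, Measurable g →
      ∫⁻ ω, g (W ω) ∂P ≤ ENNReal.ofReal ηp * ∫⁻ s, g s ∂(densMeasure ν) := fun g hg => by
    rw [← lintegral_map hg hW, ← smul_eq_mul, ← lintegral_smul_measure]
    exact lintegral_mono' h1 le_rfl
  refine ⟨h0, fun g hg => ?_⟩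
  have hm : Measurable fun ω => ENNReal.ofReal (U ω ^ 4) := (hUm.pow_const 4).ennreal_ofReal
  calc ∫⁻ ω, ENNReal.ofReal (U ω ^ 4) * g (W ω) ∂P
      = ∫⁻ ω, g (W ω) ∂(P.withDensity fun ω => ENNReal.ofReal (U ω ^ 4)) :=
        (lintegral_withDensity_eq_lintegral_mul _ hm (hg.comp hW)).symm
    _ = ∫⁻ s, g s ∂((P.withDensity fun ω => ENNReal.ofReal (U ω ^ 4)).map W) :=
        (lintegral_map hg hW).symm
    _ ≤ ∫⁻ s, g s ∂(ENNReal.ofReal (σ ^ 4) • P.map W) :=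
        lintegral_mono' (map_withDensity_pow_four_le hW hU hσ) le_rfl
    _ = ENNReal.ofReal (σ ^ 4) * ∫⁻ ω, g (W ω) ∂P := by
        rw [lintegral_smul_measure, smul_eq_mul, lintegral_map hg hW]
    _ ≤ ENNReal.ofReal (σ ^ 4) * (ENNReal.ofReal ηp * ∫⁻ s, g s ∂(densMeasure ν)) := by
        gcongr; exact h0 g hg
    _ = _ := by rw [← mul_assoc, ← ENNReal.ofReal_mul (by positivity)]

end Density

section Basis

variable {k : ℕ} {μ : Measure (Vec k)} {f : ℕ → Vec k → ℝ}

/-- Parseval, stated with lower integrals so that it feeds `DominatedMoments` without integrability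
conditions. The injection `e` allows indices in `Fin m` as well as in ℕ. -/
lemma lintegral_sq_sum_basis (hb : IsOrthonormalBasisL2 μ f) {ι : Type*} (s : Finset ι)
    (e : ι → ℕ) (he : Function.Injective e) (c : ι → ℝ) :
    ∫⁻ x, ENNReal.ofReal ((∑ j ∈ s, c j * f (e j) x) ^ 2) ∂μ
      = ENNReal.ofReal (∑ j ∈ s, c j ^ 2) := by
  obtain ⟨b, hbf⟩ := hb
  set F : Lp ℝ 2 μ := ∑ j ∈ s, c j • b (e j) with hF
  have hFae : (F : Vec k → ℝ) =ᵐ[μ] fun x => ∑ j ∈ s, c j * f (e j) x := by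
    have h1 : (F : Vec k → ℝ) =ᵐ[μ] fun x => ∑ j ∈ s, (c j • b (e j) : Lp ℝ 2 μ) x := by
      rw [hF]
      exact Lp.coeFn_fun_finsetSum _ _
    have h2 : ∀ᵐ x ∂μ, ∀ j ∈ s, (c j • b (e j) : Lp ℝ 2 μ) x = c j * f (e j) x := by
      rw [eventually_all_finset]
      intro j hj
      filter_upwards [Lp.coeFn_smul (c j) (b (e j)), hbf (e j)] with x hx hx'
      rw [hx, Pi.smul_apply, hx', smul_eq_mul]
    filter_upwards [h1, h2] with x hx hx'
    rw [hx, Finset.sum_congr rfl hx']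
  have hnorm : ‖F‖ ^ 2 = ∑ j ∈ s, c j ^ 2 := by
    have horth : Orthonormal ℝ fun j : ι => b (e j) := b.orthonormal.comp e he
    rw [← real_inner_self_eq_norm_sq, hF, horth.inner_sum]
    simp [pow_two]
  have hint : ∫ x, F x ^ 2 ∂μ = ‖F‖ ^ 2 := by
    rw [← real_inner_self_eq_norm_sq, L2.inner_def]
    simp [pow_two]
  rw [← hnorm, ← hint, ofReal_integral_eq_lintegral_ofReal (Lp.memLp F).integrable_sq
    (.of_forall fun x => sq_nonneg _)]
  refine lintegral_congr_ae ?_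
  filter_upwards [hFae] with x hx
  rw [hx]

end Basis

end NPIV

/-! ### Score vectors and their moments. -/

namespace NPIV

variable {Ω : Type*} [MeasurableSpace Ω] {P : Measure Ω}

/-- In coordinates ⟪Σx, x⟫ = ∑ s_jl x_j x_l, and integrating over x produces a second factor s_jl.
-/
lemma covNormSq_eq_sum {m : ℕ} {Q : Measure (EuclideanSpace ℝ (Fin m))} [IsProbabilityMeasure Q]
    (h : MemLp id 4 Q) : covNormSq Q = ∑ j, ∑ l, (∫ z, z j * z l ∂Q) ^ 2 := by
  have h2 : MemLp id 2 Q := memLp_two_of_four h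
  have hcoord : ∀ j, MemLp (fun z : EuclideanSpace ℝ (Fin m) => z j) 2 Q := fun j =>
    (EuclideanSpace.proj j : EuclideanSpace ℝ (Fin m) →L[ℝ] ℝ).comp_memLp' h2
  have hi : ∀ j l, Integrable (fun z : EuclideanSpace ℝ (Fin m) => z j * z l) Q := fun j l =>
    (hcoord j).integrable_mul (hcoord l)
  set s : Fin m → Fin m → ℝ := fun j l => ∫ z, z j * z l ∂Q
  have hquad : ∀ x : EuclideanSpace ℝ (Fin m),
      ⟪covarianceOperator Q x, x⟫ = ∑ j, ∑ l, s j l * (x j * x l) := fun x => by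
    rw [cov_self h]
    have hexp : ∀ z : EuclideanSpace ℝ (Fin m),
        ⟪x, z⟫ ^ 2 = ∑ j, ∑ l, (x j * x l) * (z j * z l) := fun z => by
      rw [PiLp.inner_apply, pow_two, Finset.sum_mul_sum]
      refine Finset.sum_congr rfl fun j _ => Finset.sum_congr rfl fun l _ => ?_
      simp only [RCLike.inner_apply, conj_trivial]
      ring
    simp_rw [hexp]
    rw [integral_finsetSum _ fun j _ => integrable_finsetSum _ fun l _ => (hi j l).const_mul _]
    refine Finset.sum_congr rfl fun j _ => ?_
    rw [integral_finsetSum _ fun l _ => (hi j l).const_mul _]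
    refine Finset.sum_congr rfl fun l _ => ?_
    rw [integral_const_mul, mul_comm]
  rw [covNormSq]
  simp_rw [hquad]
  rw [integral_finsetSum _ fun j _ => integrable_finsetSum _ fun l _ => (hi j l).const_mul _]
  refine Finset.sum_congr rfl fun j _ => ?_
  rw [integral_finsetSum _ fun l _ => (hi j l).const_mul _]
  refine Finset.sum_congr rfl fun l _ => ?_
  rw [integral_const_mul, pow_two]

section Score

variable {k : ℕ} {W : Ω → Vec k} {U : Ω → ℝ} {τ : ℕ → ℝ} {f : ℕ → Vec k → ℝ}

/-- The vector `(u f_j^τ(w))_{j < m}`. -/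
noncomputable def scoreVec (τ : ℕ → ℝ) (f : ℕ → Vec k → ℝ) (m : ℕ) (u : ℝ) (w : Vec k) :
    EuclideanSpace ℝ (Fin m) :=
  WithLp.toLp 2 fun j => u * fw τ f j w

@[simp] lemma scoreVec_apply (m : ℕ) (u : ℝ) (w : Vec k) (j : Fin m) :
    scoreVec τ f m u w j = u * fw τ f j w := rfl

lemma measurable_fw (hf : ∀ j, Measurable (f j)) (j : ℕ) : Measurable (fw τ f j) :=
  (hf j).const_mul _

lemma measurable_scoreVec (hf : ∀ j, Measurable (f j)) (m : ℕ) {α : Type*} [MeasurableSpace α]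
    {u : α → ℝ} {w : α → Vec k} (hu : Measurable u) (hw : Measurable w) :
    Measurable fun a => scoreVec τ f m (u a) (w a) :=
  (WithLp.measurable_toLp 2 (Fin m → ℝ)).comp
    (measurable_pi_lambda _ fun j => hu.mul ((measurable_fw hf j).comp hw))

lemma norm_scoreVec_sq (hτ : IsWeighting τ) (m : ℕ) (u : ℝ) (w : Vec k) :
    ‖scoreVec τ f m u w‖ ^ 2 = ∑ j ∈ Finset.range m, τ j * (u * f j w) ^ 2 := by
  rw [EuclideanSpace.norm_sq_eq, ← Fin.sum_univ_eq_sum_range (fun j => τ j * (u * f j w) ^ 2)]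
  refine Finset.sum_congr rfl fun j _ => ?_
  rw [scoreVec_apply, Real.norm_eq_abs, sq_abs, fw, mul_left_comm, mul_pow,
    Real.sq_sqrt (hτ.pos _).le]

lemma inner_scoreVec (m : ℕ) (x : EuclideanSpace ℝ (Fin m)) (u : ℝ) (w : Vec k) :
    ⟪x, scoreVec τ f m u w⟫ = u * ∑ j, (x j * √(τ j)) * f j w := by
  rw [PiLp.inner_apply, Finset.mul_sum]
  refine Finset.sum_congr rfl fun j _ => ?_
  simp only [RCLike.inner_apply, conj_trivial, scoreVec_apply, fw]
  ring

/-- Linearity in the scalar: noise and local alternative merge into the residual Y_i - φ₀(Z_i) =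
cδ(Z_i) + U_i. -/
lemma scoreVec_add_smul (m : ℕ) (u v c : ℝ) (w : Vec k) :
    scoreVec τ f m u w + c • scoreVec τ f m v w = scoreVec τ f m (c * v + u) w := by
  ext j
  simp only [PiLp.add_apply, PiLp.smul_apply, scoreVec_apply, smul_eq_mul]
  ring

lemma memLp_four_of_lintegral_le {g : Ω → ℝ} (hg : AEStronglyMeasurable g P) {c : ℝ} (hc : 0 ≤ c)
    (h : ∫⁻ ω, ENNReal.ofReal (g ω ^ 4) ∂P ≤ ENNReal.ofReal c) :
    MemLp g 4 P ∧ ∫ ω, g ω ^ 4 ∂P ≤ c := by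
  have hnn : 0 ≤ᵐ[P] fun ω => g ω ^ 4 := .of_forall fun ω => by positivity
  have hi : Integrable (fun ω => g ω ^ 4) P :=
    (lintegral_ofReal_ne_top_iff_integrable (hg.pow 4) hnn).1 (h.trans_lt ENNReal.ofReal_lt_top).ne
  refine ⟨memLp_four_of_integrable hg ?_, ?_⟩
  · simpa [Even.pow_abs (show Even 4 by decide)] using hi
  · rw [integral_eq_lintegral_of_nonneg_ae hnn (hg.pow 4)]
    exact ENNReal.toReal_le_of_le_ofReal hc h

lemma integral_sq_le_of_lintegral_le {g : Ω → ℝ} (hg : AEStronglyMeasurable g P) {c : ℝ}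
    (hc : 0 ≤ c) (h : ∫⁻ ω, ENNReal.ofReal (g ω ^ 2) ∂P ≤ ENNReal.ofReal c) :
    MemLp g 2 P ∧ ∫ ω, g ω ^ 2 ∂P ≤ c := by
  have hnn : 0 ≤ᵐ[P] fun ω => g ω ^ 2 := .of_forall fun ω => by positivity
  have hi : Integrable (fun ω => g ω ^ 2) P :=
    (lintegral_ofReal_ne_top_iff_integrable (hg.pow 2) hnn).1 (h.trans_lt ENNReal.ofReal_lt_top).ne
  refine ⟨(memLp_two_iff_integrable_sq hg).2 hi, ?_⟩
  rw [integral_eq_lintegral_of_nonneg_ae hnn (hg.pow 2)]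
  exact ENNReal.toReal_le_of_le_ofReal hc h

namespace DominatedMoments

variable {ν : Vec k → ℝ} {a b : ℝ} (hD : DominatedMoments P W U ν a b) (ha : 0 ≤ a) (hb : 0 ≤ b)
  (hW : Measurable W) (hU : Measurable U) (hf : ∀ j, Measurable (f j))

section FourthMoments

variable {ηf : ℝ} (hη : 0 ≤ ηf)
  (hf4 : ∀ j, ∫⁻ s, ENNReal.ofReal (|f j s| ^ 4) ∂(densMeasure ν) ≤ ENNReal.ofReal ηf)

include hD ha hW hf hη hf4 in
lemma memLp_basis (j : ℕ) :
    MemLp (fun ω => f j (W ω)) 4 P ∧ ∫ ω, f j (W ω) ^ 4 ∂P ≤ a * ηf := by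
  refine memLp_four_of_lintegral_le ((hf j).comp hW).aestronglyMeasurable (by positivity) ?_
  refine (hD.lintegral_le (fun s => ENNReal.ofReal (f j s ^ 4))
    ((hf j).pow_const 4).ennreal_ofReal).trans ?_
  rw [ENNReal.ofReal_mul ha]
  gcongr
  simpa [Even.pow_abs (show Even 4 by decide)] using hf4 j

include hD hb hW hU hf hη hf4 in
lemma memLp_mul_basis (j : ℕ) :
    MemLp (fun ω => U ω * f j (W ω)) 4 P ∧ ∫ ω, (U ω * f j (W ω)) ^ 4 ∂P ≤ b * ηf := by
  refine memLp_four_of_lintegral_le (hU.mul ((hf j).comp hW)).aestronglyMeasurable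
    (by positivity) ?_
  have hrw : ∀ ω, ENNReal.ofReal ((U ω * f j (W ω)) ^ 4)
      = ENNReal.ofReal (U ω ^ 4) * ENNReal.ofReal (f j (W ω) ^ 4) := fun ω => by
    rw [mul_pow, ENNReal.ofReal_mul (by positivity)]
  refine (lintegral_congr hrw).trans_le ?_
  refine (hD.lintegral_pow_four_le (fun s => ENNReal.ofReal (f j s ^ 4))
    ((hf j).pow_const 4).ennreal_ofReal).trans ?_
  rw [ENNReal.ofReal_mul hb]
  gcongr
  simpa [Even.pow_abs (show Even 4 by decide)] using hf4 j

include hD hb hW hU hf hη hf4 in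
lemma memLp_scoreVec (m : ℕ) : MemLp (fun ω => scoreVec τ f m (U ω) (W ω)) 4 P := by
  refine MemLp.of_eval_piLp fun j => ?_
  refine ((hD.memLp_mul_basis hb hW hU hf hη hf4 j).1.const_mul √(τ j)).congr_norm
    (hU.mul ((measurable_fw hf j).comp hW)).aestronglyMeasurable (.of_forall fun ω => ?_)
  rw [scoreVec_apply, fw, mul_left_comm]

include hD hb hW hU hf hη hf4 in
-- Weighted Cauchy–Schwarz, (∑ τ_j g_j²)² ≤ (∑ τ_j)(∑ τ_j g_j⁴), reduces the claim to the uniform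
-- bound on each E g_j⁴.
lemma integral_norm_scoreVec_pow_four_le (hτ : IsWeighting τ) (m : ℕ) :
    ∫ ω, ‖scoreVec τ f m (U ω) (W ω)‖ ^ 4 ∂P ≤ b * ηf * (∑ j ∈ Finset.range m, τ j) ^ 2 := by
  set g : ℕ → Ω → ℝ := fun j ω => U ω * f j (W ω)
  have hg := fun j => hD.memLp_mul_basis hb hW hU hf hη hf4 j
  have hgi : ∀ j, Integrable (fun ω => g j ω ^ 4) P := fun j =>
    integrable_pow_four (hg j).1
  have hτ0 : ∀ j ∈ Finset.range m, 0 ≤ τ j := fun j _ => (hτ.pos j).le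
  calc _ ≤ ∫ ω, (∑ j ∈ Finset.range m, τ j) * ∑ j ∈ Finset.range m, τ j * g j ω ^ 4 ∂P := by
        refine integral_mono_of_nonneg (.of_forall fun ω => by positivity)
          ((integrable_finsetSum _ fun j _ => (hgi j).const_mul _).const_mul _)
          (.of_forall fun ω => ?_)
        change ‖scoreVec τ f m (U ω) (W ω)‖ ^ 4 ≤ _
        rw [show ‖scoreVec τ f m (U ω) (W ω)‖ ^ 4 = (‖scoreVec τ f m (U ω) (W ω)‖ ^ 2) ^ 2 by ring,
          norm_scoreVec_sq hτ]
        refine Finset.sum_sq_le_sum_mul_sum_of_sq_le_mul _ hτ0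
          (fun j hj => mul_nonneg (hτ0 j hj) (by positivity)) fun j _ => ?_
        refine le_of_eq ?_
        simp only [g]
        ring
    _ = (∑ j ∈ Finset.range m, τ j) * ∑ j ∈ Finset.range m, τ j * ∫ ω, g j ω ^ 4 ∂P := by
        rw [integral_const_mul, integral_finsetSum _ fun j _ => (hgi j).const_mul _]
        simp only [integral_const_mul]
    _ ≤ (∑ j ∈ Finset.range m, τ j) * ∑ j ∈ Finset.range m, τ j * (b * ηf) := by
        refine mul_le_mul_of_nonneg_left (Finset.sum_le_sum fun j hj => ?_)
          (Finset.sum_nonneg hτ0)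
        exact mul_le_mul_of_nonneg_left (hg j).2 (hτ0 j hj)
    _ = _ := by rw [← Finset.sum_mul]; ring

variable {D : Ω → ℝ} (hDm : Measurable D) (hD4 : MemLp D 4 P)

include hD ha hW hf hη hf4 hD4 in
-- Cauchy–Schwarz between the squares. `D` has four moments but no conditional bound given W, so the
-- product is controlled only in L².
lemma memLp_two_mul_basis (j : ℕ) :
    MemLp (fun ω => D ω * f j (W ω)) 2 P ∧
      ∫ ω, (D ω * f j (W ω)) ^ 2 ∂P ≤ √(∫ ω, D ω ^ 4 ∂P) * √(a * ηf) := by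
  obtain ⟨h1, h2⟩ := hD.memLp_basis ha hW hf hη hf4 j
  have hcs := integral_abs_mul_le_sqrt (memLp_two_sq hD4) (memLp_two_sq h1)
  have hint := (memLp_two_sq hD4).integrable_mul (memLp_two_sq h1)
  have hrw : ∀ ω, (D ω * f j (W ω)) ^ 2 = D ω ^ 2 * f j (W ω) ^ 2 := fun ω => by ring
  refine ⟨(memLp_two_iff_integrable_sq (hD4.1.mul h1.1)).2
    (hint.congr (.of_forall fun ω => (hrw ω).symm)), ?_⟩
  simp_rw [hrw]
  refine (integral_mono hint hint.abs fun ω => le_abs_self _).trans (hcs.trans ?_)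
  simp only [← pow_mul]
  gcongr

include hD ha hW hf hη hf4 hDm hD4 in
lemma memLp_two_scoreVec (m : ℕ) : MemLp (fun ω => scoreVec τ f m (D ω) (W ω)) 2 P := by
  refine MemLp.of_eval_piLp fun j => ?_
  refine ((hD.memLp_two_mul_basis ha hW hf hη hf4 hD4 j).1.const_mul √(τ j)).congr_norm
    (hDm.mul ((measurable_fw hf j).comp hW)).aestronglyMeasurable (.of_forall fun ω => ?_)
  rw [scoreVec_apply, fw, mul_left_comm]

include hD ha hW hf hη hf4 hD4 in
lemma integral_norm_scoreVec_sq_le (hτ : IsWeighting τ) (m : ℕ) :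
    ∫ ω, ‖scoreVec τ f m (D ω) (W ω)‖ ^ 2 ∂P
      ≤ √(∫ ω, D ω ^ 4 ∂P) * √(a * ηf) * ∑ j ∈ Finset.range m, τ j := by
  have hg := fun j => hD.memLp_two_mul_basis ha hW hf hη hf4 hD4 j
  simp_rw [norm_scoreVec_sq hτ]
  rw [integral_finsetSum _ fun j _ => (hg j).1.integrable_sq.const_mul _, Finset.mul_sum]
  refine Finset.sum_le_sum fun j _ => ?_
  rw [integral_const_mul, mul_comm]
  exact mul_le_mul_of_nonneg_right (hg j).2 (hτ.pos j).le

end FourthMoments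

section Orthonormal

variable (hbasis : IsOrthonormalBasisL2 (densMeasure ν) f)
  {ι : Type*} (s : Finset ι) (e : ι → ℕ) (he : Function.Injective e) (c : ι → ℝ)

include hD ha hW hf hbasis he in
lemma integral_sum_basis_sq_le :
    MemLp (fun ω => ∑ j ∈ s, c j * f (e j) (W ω)) 2 P ∧
      ∫ ω, (∑ j ∈ s, c j * f (e j) (W ω)) ^ 2 ∂P ≤ a * ∑ j ∈ s, c j ^ 2 := by
  have hm : Measurable fun x => ∑ j ∈ s, c j * f (e j) x :=
    Finset.measurable_fun_sum _ fun j _ => (hf _).const_mul _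
  refine integral_sq_le_of_lintegral_le (hm.comp hW).aestronglyMeasurable
    (mul_nonneg ha (Finset.sum_nonneg fun j _ => sq_nonneg _)) ?_
  rw [ENNReal.ofReal_mul ha, ← lintegral_sq_sum_basis hbasis s e he c]
  exact hD.lintegral_le _ (hm.pow_const 2).ennreal_ofReal

include hD ha hb hW hU hf hbasis he in
-- Since U² ≤ 1 + U⁴, the two dominations of `DominatedMoments` can be added; hence the constant a +
-- b.
lemma integral_mul_sum_basis_sq_le :
    ∫ ω, (U ω * ∑ j ∈ s, c j * f (e j) (W ω)) ^ 2 ∂P ≤ (a + b) * ∑ j ∈ s, c j ^ 2 := by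
  set h : Vec k → ℝ := fun x => ∑ j ∈ s, c j * f (e j) x
  have hm : Measurable h := Finset.measurable_fun_sum _ fun j _ => (hf _).const_mul _
  have hc : 0 ≤ ∑ j ∈ s, c j ^ 2 := Finset.sum_nonneg fun j _ => sq_nonneg _
  refine (integral_sq_le_of_lintegral_le (hU.mul (hm.comp hW)).aestronglyMeasurable
    (mul_nonneg (add_nonneg ha hb) hc) ?_).2
  have hm2 : Measurable fun x => ENNReal.ofReal (h x ^ 2) := (hm.pow_const 2).ennreal_ofReal
  calc ∫⁻ ω, ENNReal.ofReal ((U ω * h (W ω)) ^ 2) ∂P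
      ≤ ∫⁻ ω, (ENNReal.ofReal (h (W ω) ^ 2)
          + ENNReal.ofReal (U ω ^ 4) * ENNReal.ofReal (h (W ω) ^ 2)) ∂P := by
        refine lintegral_mono fun ω => ?_
        rw [← ENNReal.ofReal_mul (by positivity), ← ENNReal.ofReal_add (by positivity)
          (by positivity)]
        refine ENNReal.ofReal_le_ofReal ?_
        nlinarith [mul_nonneg (sq_nonneg (h (W ω))) (sq_nonneg (U ω ^ 2 - 1)),
          mul_nonneg (sq_nonneg (h (W ω))) (sq_nonneg (U ω)),
          mul_nonneg (sq_nonneg (h (W ω))) (sq_nonneg (U ω ^ 2)), sq_nonneg (h (W ω))]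
    _ = ∫⁻ ω, ENNReal.ofReal (h (W ω) ^ 2) ∂P
          + ∫⁻ ω, ENNReal.ofReal (U ω ^ 4) * ENNReal.ofReal (h (W ω) ^ 2) ∂P :=
        lintegral_add_left (hm2.comp hW) _
    _ ≤ ENNReal.ofReal a * ∫⁻ x, ENNReal.ofReal (h x ^ 2) ∂(densMeasure ν)
          + ENNReal.ofReal b * ∫⁻ x, ENNReal.ofReal (h x ^ 2) ∂(densMeasure ν) :=
        add_le_add (hD.lintegral_le _ hm2) (hD.lintegral_pow_four_le _ hm2)
    _ = _ := by
        rw [lintegral_sq_sum_basis hbasis s e he c, ← add_mul, ← ENNReal.ofReal_add ha hb,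
          ENNReal.ofReal_mul (add_nonneg ha hb)]

include hD ha hb hW hU hf hbasis in
-- Bounds the quadratic form of Σ_m uniformly in m: Parseval for the coefficients x_j √τ_j, and τ_j
-- ≤ 1.
lemma integral_inner_scoreVec_sq_le (hτ : IsWeighting τ) {m : ℕ} (x : EuclideanSpace ℝ (Fin m)) :
    ∫ ω, ⟪x, scoreVec τ f m (U ω) (W ω)⟫ ^ 2 ∂P ≤ (a + b) * ‖x‖ ^ 2 := by
  simp_rw [inner_scoreVec]
  refine (hD.integral_mul_sum_basis_sq_le ha hb hW hU hf hbasis Finset.univ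
    (fun j : Fin m => (j : ℕ)) Fin.val_injective fun j => x j * √(τ j)).trans ?_
  refine mul_le_mul_of_nonneg_left ?_ (add_nonneg ha hb)
  rw [EuclideanSpace.norm_sq_eq]
  refine Finset.sum_le_sum fun j _ => ?_
  rw [mul_pow, Real.sq_sqrt (hτ.pos _).le, Real.norm_eq_abs, sq_abs]
  exact mul_le_of_le_one_right (sq_nonneg _) (hτ.first ▸ hτ.antitone (Nat.zero_le _))

include hD ha hW hf hbasis in
/-- Bessel's inequality for the functions `f_j(W)`. -/
lemma sum_integral_mul_basis_sq_le {D : Ω → ℝ} (hDL : MemLp D 2 P)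
    (hi : ∀ j, Integrable (fun ω => D ω * f j (W ω)) P) (m : ℕ) :
    ∑ j ∈ Finset.range m, (∫ ω, D ω * f j (W ω) ∂P) ^ 2 ≤ a * ∫ ω, D ω ^ 2 ∂P := by
  set c : ℕ → ℝ := fun j => ∫ ω, D ω * f j (W ω) ∂P
  set S := ∑ j ∈ Finset.range m, c j ^ 2
  have hS0 : 0 ≤ S := Finset.sum_nonneg fun j _ => sq_nonneg _
  obtain ⟨hL, hle⟩ := hD.integral_sum_basis_sq_le ha hW hf hbasis (Finset.range m) id
    Function.injective_id c
  -- The sum S is E[D h(W)] for h = ∑ c_j f_j, and domination gives E h(W)² ≤ aS. Hence S² ≤ E D² ·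
  -- aS, and one divides by S unless S = 0.
  have hSeq : S = ∫ ω, D ω * ∑ j ∈ Finset.range m, c j * f (id j) (W ω) ∂P := by
    simp_rw [Finset.mul_sum, mul_left_comm _ (c _), id]
    rw [integral_finsetSum _ fun j _ => (hi j).const_mul _]
    refine Finset.sum_congr rfl fun j _ => ?_
    rw [integral_const_mul, pow_two]
  have hcs : S ≤ √(∫ ω, D ω ^ 2 ∂P) * √(a * S) := by
    calc S ≤ ∫ ω, |D ω * ∑ j ∈ Finset.range m, c j * f (id j) (W ω)| ∂P := by
          rw [hSeq]
          exact (le_abs_self _).trans abs_integral_le_integral_abs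
      _ ≤ _ := integral_abs_mul_le_sqrt hDL hL
      _ ≤ _ := by gcongr
  have hD0 : 0 ≤ ∫ ω, D ω ^ 2 ∂P := integral_nonneg fun ω => sq_nonneg _
  have hsq := pow_le_pow_left₀ hS0 hcs 2
  rw [mul_pow, Real.sq_sqrt hD0, Real.sq_sqrt (mul_nonneg ha hS0)] at hsq
  rcases hS0.eq_or_lt with h0 | h0
  · rw [← h0]; positivity
  · nlinarith

end Orthonormal

end DominatedMoments

end Score

end NPIV

/-! ### Law of the score vectors, and consequences of the rate conditions. -/

namespace NPIV

variable {Ω : Type*} [MeasurableSpace Ω] {P : Measure Ω} {k : ℕ} {W : Ω → Vec k} {U : Ω → ℝ}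
  {τ : ℕ → ℝ} {f : ℕ → Vec k → ℝ}

/-- g(W) is pulled out of the conditional expectation, leaving E[U | W] = 0. This centres the score
vectors. -/
lemma integral_mul_comp_eq_zero [IsProbabilityMeasure P] (hW : Measurable W)
    (hUW : P[U | sigmaOf W] =ᵐ[P] 0) (hU : Integrable U P) {g : Vec k → ℝ} (hg : Measurable g)
    (hi : Integrable (fun ω => U ω * g (W ω)) P) : ∫ ω, U ω * g (W ω) ∂P = 0 := by
  have hgW : StronglyMeasurable[sigmaOf W] (g ∘ W) :=
    (hg.comp (comap_measurable W)).stronglyMeasurable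
  have h : P[U * (g ∘ W) | sigmaOf W] =ᵐ[P] P[U | sigmaOf W] * (g ∘ W) :=
    condExp_mul_of_stronglyMeasurable_right hgW hi hU
  have h0 : P[U * (g ∘ W) | sigmaOf W] =ᵐ[P] 0 := by
    filter_upwards [h, hUW] with ω h1 h2
    rw [h1, Pi.mul_apply, h2, Pi.zero_apply, zero_mul]
  calc ∫ ω, U ω * g (W ω) ∂P = ∫ ω, (P[U * (g ∘ W) | sigmaOf W]) ω ∂P :=
        (integral_condExp hW.comap_le).symm
    _ = 0 := by rw [integral_congr_ae h0]; simp

lemma integral_scoreVec_apply {m : ℕ} (h : Integrable (fun ω => scoreVec τ f m (U ω) (W ω)) P)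
    (j : Fin m) :
    (∫ ω, scoreVec τ f m (U ω) (W ω) ∂P) j = √(τ j) * ∫ ω, U ω * f j (W ω) ∂P := by
  rw [← integral_const_mul]
  refine ((EuclideanSpace.proj j : EuclideanSpace ℝ (Fin m) →L[ℝ] ℝ).integral_comp_comm h).symm.trans
    (integral_congr_ae (.of_forall fun ω => ?_))
  change U ω * fw τ f j (W ω) = _
  rw [fw, mul_left_comm]

/-- Identifies the quadratic form with n times the test statistic; for n = 0 both sides are 0. -/
lemma norm_partialSum_scoreVec (hτ : IsWeighting τ) (m n : ℕ) (u : ℕ → ℝ) (w : ℕ → Vec k) :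
    ‖partialSum (fun i => scoreVec τ f m (u i) (w i)) n‖ ^ 2 / n =
      n * ∑ j ∈ Finset.range m, τ j *
        |(n : ℝ)⁻¹ * ∑ i ∈ Finset.range n, u i * f j (w i)| ^ 2 := by
  rcases eq_or_ne n 0 with rfl | hn
  · simp
  have hn' : (n : ℝ) ≠ 0 := Nat.cast_ne_zero.2 hn
  rw [EuclideanSpace.norm_sq_eq, Finset.sum_div, Finset.mul_sum,
    ← Fin.sum_univ_eq_sum_range (fun j => (n : ℝ) * (τ j *
        |(n : ℝ)⁻¹ * ∑ i ∈ Finset.range n, u i * f j (w i)| ^ 2))]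
  refine Finset.sum_congr rfl fun j _ => ?_
  have hj : partialSum (fun i => scoreVec τ f m (u i) (w i)) n j
      = √(τ j) * ∑ i ∈ Finset.range n, u i * f j (w i) := by
    rw [partialSum, WithLp.ofLp_sum, Finset.sum_apply, Finset.mul_sum]
    refine Finset.sum_congr rfl fun i _ => ?_
    rw [scoreVec_apply, fw, mul_left_comm]
  rw [hj, Real.norm_eq_abs, sq_abs, sq_abs, mul_pow, mul_pow, Real.sq_sqrt (hτ.pos _).le]
  field_simp

section Law

variable (hf : ∀ j, Measurable (f j)) (hW : Measurable W)
  (hU : Measurable U)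

include hf hW hU in
lemma memLp_id_map_scoreVec {m : ℕ} (h : MemLp (fun ω => scoreVec τ f m (U ω) (W ω)) 4 P) :
    MemLp id 4 (P.map fun ω => scoreVec τ f m (U ω) (W ω)) :=
  (memLp_map_measure_iff aestronglyMeasurable_id (measurable_scoreVec hf m hU hW).aemeasurable).2 h

include hf hW hU in
lemma sqrt_covNormSq_map_scoreVec [IsProbabilityMeasure P] {m : ℕ}
    (h : MemLp (fun ω => scoreVec τ f m (U ω) (W ω)) 4 P) :
    √(covNormSq (P.map fun ω => scoreVec τ f m (U ω) (W ω))) = frobSigma P U W τ f m := by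
  have hm := measurable_scoreVec (τ := τ) hf m hU hW
  have := Measure.isProbabilityMeasure_map (μ := P) hm.aemeasurable
  have hs : ∀ j l : Fin m, ∫ z, z j * z l ∂(P.map fun ω => scoreVec τ f m (U ω) (W ω))
      = sEntry P U W τ f j l := fun j l => by
    rw [integral_map hm.aemeasurable (by fun_prop)]
    refine integral_congr_ae (.of_forall fun ω => ?_)
    simp only [scoreVec_apply]
    ring
  rw [covNormSq_eq_sum (memLp_id_map_scoreVec hf hW hU h), frobSigma]
  simp_rw [hs]
  rw [← Fin.sum_univ_eq_sum_range (fun j => ∑ l ∈ Finset.range m, sEntry P U W τ f j l ^ 2)]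
  simp_rw [← Fin.sum_univ_eq_sum_range (fun l => sEntry P U W τ f _ l ^ 2)]

include hf hW hU in
lemma integral_norm_sq_map_scoreVec (hτ : IsWeighting τ) {m : ℕ}
    (h : ∀ j, Integrable (fun ω => (U ω * f j (W ω)) ^ 2) P) :
    ∫ x, ‖x‖ ^ 2 ∂(P.map fun ω => scoreVec τ f m (U ω) (W ω)) = traceSigma P U W τ f m := by
  rw [integral_map (measurable_scoreVec hf m hU hW).aemeasurable (by fun_prop)]
  simp_rw [norm_scoreVec_sq hτ]
  rw [integral_finsetSum _ fun j _ => (h j).const_mul _, traceSigma]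
  refine Finset.sum_congr rfl fun j _ => integral_congr_ae (.of_forall fun ω => ?_)
  simp only [fw]
  rw [show U ω ^ 2 * (√(τ j) * f j (W ω)) * (√(τ j) * f j (W ω))
    = √(τ j) ^ 2 * (U ω * f j (W ω)) ^ 2 by ring, Real.sq_sqrt (hτ.pos j).le]

lemma frobSigma_mono : Monotone (frobSigma P U W τ f) := fun m₁ m₂ h => by
  have hsub := Finset.range_mono h
  refine Real.sqrt_le_sqrt ((Finset.sum_le_sum_of_subset_of_nonneg hsub fun j _ _ =>
    Finset.sum_nonneg fun l _ => sq_nonneg _).trans (Finset.sum_le_sum fun j _ =>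
      Finset.sum_le_sum_of_subset_of_nonneg hsub fun l _ _ => sq_nonneg _))

end Law

/-- Applied to m ↦ ς_m, it forces m_n → ∞, so that the drift collects the whole series ∑ δ_j². -/
lemma tendsto_atTop_of_tendsto_comp {g : ℕ → ℝ} (hg : Monotone g) {m : ℕ → ℕ}
    (h : Tendsto (fun n => g (m n)) atTop atTop) : Tendsto m atTop atTop := by
  refine tendsto_atTop.2 fun N => ?_
  filter_upwards [h.eventually_gt_atTop (g N)] with n hn
  exact (hg.reflect_lt hn).le

/-- For ρ ≥ 0 one has ρ² ≤ ρ³ + 1. -/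
lemma tendsto_sq_div_of_cube_isLittleO {ρ : ℕ → ℝ} (hρ : ∀ n, 0 ≤ ρ n)
    (h : (fun n => ρ n ^ 3) =o[atTop] fun n : ℕ => (n : ℝ)) :
    Tendsto (fun n => ρ n ^ 2 / n) atTop (𝓝 0) := by
  have h1 := h.tendsto_div_nhds_zero.add (tendsto_inv_atTop_nhds_zero_nat (𝕜 := ℝ))
  rw [add_zero] at h1
  refine squeeze_zero (fun n => by positivity) (fun n => ?_) h1
  rw [← one_div, ← add_div]
  refine div_le_div_of_nonneg_right ?_ (Nat.cast_nonneg n)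
  nlinarith [hρ n, mul_nonneg (hρ n) (sq_nonneg (ρ n - 1)), sq_nonneg (ρ n - 1)]

end NPIV

/-! ### Assembly of the theorem. -/

open NPIV

theorem mainTheorem9 {Ω : Type*} [MeasurableSpace Ω] (P : Measure Ω) [IsProbabilityMeasure P]
    {dz dw : ℕ}
    -- the population variables of the model, with `E[U | W] = 0`
    (Z : Ω → NPIV.Vec dz) (W : Ω → NPIV.Vec dw) (U : Ω → ℝ)
    (hZ : Measurable Z) (hW : Measurable W) (hU : Measurable U)
    (hUW : P[U | NPIV.sigmaOf W] =ᵐ[P] 0)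
    -- the density of `W`, the reference density `ν`, and the basis of `L²(ν)`
    (pW ν : NPIV.Vec dw → ℝ) (hpW : NPIV.IsProbDensity pW) (hν : NPIV.IsProbDensity ν)
    (hWlaw : P.map W = NPIV.densMeasure pW)
    (f : ℕ → NPIV.Vec dw → ℝ) (hf : ∀ j, Measurable (f j))
    (hbasis : NPIV.IsOrthonormalBasisL2 (NPIV.densMeasure ν) f)
    (τ : ℕ → ℝ)
    -- the four standing assumptions
    (hA1 : NPIV.BasisAndDensityBounds P W pW ν f)
    (hA2 : NPIV.CondFourthMomentBound P W U)
    (hA3 : NPIV.CondExpNonsingular P Z W)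
    (hA4 : NPIV.IsWeighting τ)
    -- the truncation: `ς_{m_n}⁻¹ = o(1)` and `(∑_{j ≤ m_n} τ_j)³ = o(n)`
    (m : ℕ → ℕ)
    (hm₁ : Tendsto (fun n => NPIV.frobSigma P U W τ f (m n)) atTop atTop)
    (hm₂ : (fun n => (∑ j ∈ Finset.range (m n), τ j) ^ 3) =o[atTop] (fun n : ℕ => (n : ℝ)))
    -- the direction `δ ∈ L⁴_Z` of the local alternatives and the hypothesized function `φ₀`
    (φ₀ δ : NPIV.Vec dz → ℝ) (hφ₀ : Measurable φ₀) (hδ : Measurable δ)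
    (hδ4 : MemLp (fun ω => δ (Z ω)) 4 P)
    -- i.i.d. copies `(Z_i, W_i, U_i)` of `(Z, W, U)`
    (Zs : ℕ → Ω → NPIV.Vec dz) (Ws : ℕ → Ω → NPIV.Vec dw) (Us : ℕ → Ω → ℝ)
    (hindep : iIndepFun (fun (i : ℕ) (ω : Ω) => (Zs i ω, Ws i ω, Us i ω)) P)
    (hident : ∀ i, IdentDistrib (fun ω => (Zs i ω, Ws i ω, Us i ω))
      (fun ω => (Z ω, W ω, U ω)) P P)
    -- the responses in the `n`-th sample, under the `n`-th local alternative
    (Y : ℕ → ℕ → Ω → ℝ)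
    (hY : ∀ n, ∀ i < n, ∀ᵐ ω ∂P, Y n i ω = φ₀ (Zs i ω)
      + Real.sqrt (NPIV.frobSigma P U W τ f (m n)) / Real.sqrt n * δ (Zs i ω) + Us i ω) :
    Summable (fun j => NPIV.deltaCoef P Z W τ f δ j ^ 2) ∧
    TendstoInDistribution
      (fun (n : ℕ) (ω : Ω) => (Real.sqrt 2 * NPIV.frobSigma P U W τ f (m n))⁻¹ *
        ((n : ℝ) * NPIV.testStat φ₀ τ f (m n) n (Y n) Zs Ws ω
          - NPIV.traceSigma P U W τ f (m n)))
      atTop (id : ℝ → ℝ) (fun _ => P)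
      (gaussianReal ((Real.sqrt 2)⁻¹ * ∑' j, NPIV.deltaCoef P Z W τ f δ j ^ 2) 1) := by
  obtain ⟨ηf, ηp, hηf1, hηp1, hf4, hsupp⟩ := hA1
  obtain ⟨hU4, σ, hσ0, hσ⟩ := hA2
  have hηf : 0 ≤ ηf := zero_le_one.trans hηf1
  have ha : 0 ≤ ηp := zero_le_one.trans hηp1
  have hb : 0 ≤ σ ^ 4 * ηp := by positivity
  have hdom := dominatedMoments hW hU hν hWlaw ha hsupp hU4 hσ
  have hδZ : Measurable fun ω => δ (Z ω) := hδ.comp hZ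
  have hδ2 : ∀ j, MemLp (fun ω => δ (Z ω) * f j (W ω)) 2 P := fun j =>
    (hdom.memLp_two_mul_basis ha hW hf hηf hf4 hδ4 j).1
  have hsum : Summable fun j => deltaCoef P Z W τ f δ j ^ 2 := by
    -- Bessel bounds the unweighted partial sums, and τ_j ≤ τ_1 = 1.
    refine summable_of_sum_range_le (c := ηp * ∫ ω, δ (Z ω) ^ 2 ∂P) (fun j => sq_nonneg _)
      fun n => le_trans (Finset.sum_le_sum fun j _ => ?_)
        (hdom.sum_integral_mul_basis_sq_le ha hW hf hbasis (memLp_two_of_four hδ4)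
          (fun j => (hδ2 j).integrable one_le_two) n)
    rw [deltaCoef, mul_pow, Real.sq_sqrt (hA4.pos j).le]
    exact mul_le_of_le_one_left (sq_nonneg _) (hA4.first ▸ hA4.antitone (Nat.zero_le j))
  refine ⟨hsum, ?_⟩
  have hT : Measurable fun ω => (Z ω, W ω, U ω) := hZ.prodMk (hW.prodMk hU)
  -- measurable versions of the observations
  set ζ : ℕ → Ω → Vec dz × Vec dw × ℝ := fun i => (hident i).aemeasurable_fst.mk _ with hζ
  have hζm : ∀ i, Measurable (ζ i) := fun i => (hident i).aemeasurable_fst.measurable_mk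
  have hζe : ∀ i, (fun ω => (Zs i ω, Ws i ω, Us i ω)) =ᵐ[P] ζ i := fun i =>
    (hident i).aemeasurable_fst.ae_eq_mk
  have hζi : iIndepFun ζ P := hindep.congr hζe
  have hζl : ∀ i, IdentDistrib (ζ i) (fun ω => (Z ω, W ω, U ω)) P P := fun i =>
    ⟨(hζm i).aemeasurable, hT.aemeasurable,
      (Measure.map_congr (hζe i)).symm.trans (hident i).map_eq⟩
  have hφX : ∀ n, Measurable fun t : Vec dz × Vec dw × ℝ => scoreVec τ f (m n) t.2.2 t.2.1 :=
    fun n => measurable_scoreVec hf (m n) measurable_snd.snd measurable_snd.fst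
  have hφG : ∀ n, Measurable fun t : Vec dz × Vec dw × ℝ => scoreVec τ f (m n) (δ t.1) t.2.1 :=
    fun n => measurable_scoreVec hf (m n) (hδ.comp measurable_fst) measurable_snd.fst
  have hXL : ∀ n, MemLp (fun ω => scoreVec τ f (m n) (U ω) (W ω)) 4 P := fun n =>
    hdom.memLp_scoreVec hb hW hU hf hηf hf4 (m n)
  have hGL : ∀ n, MemLp (fun ω => scoreVec τ f (m n) (δ (Z ω)) (W ω)) 2 P := fun n =>
    hdom.memLp_two_scoreVec ha hW hf hηf hf4 hδZ hδ4 (m n)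
  have hUf : ∀ j, MemLp (fun ω => U ω * f j (W ω)) 4 P := fun j =>
    (hdom.memLp_mul_basis hb hW hU hf hηf hf4 j).1
  set Q : ∀ n, Measure (EuclideanSpace ℝ (Fin (m n))) := fun n =>
    P.map fun ω => scoreVec τ f (m n) (U ω) (W ω) with hQ
  have hXm : ∀ n, Measurable fun ω => scoreVec τ f (m n) (U ω) (W ω) := fun n =>
    measurable_scoreVec hf (m n) hU hW
  have hsample : ∀ n, IsCentredSample P (Q n)
      fun i ω => scoreVec τ f (m n) (ζ i ω).2.2 (ζ i ω).2.1 := fun n =>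
    { measurable := fun i => (hφX n).comp (hζm i)
      indep := hζi.comp _ fun _ => hφX n
      law := fun i => ((hζl i).comp (hφX n)).map_eq
      memLp_id := memLp_id_map_scoreVec hf hW hU (hXL n)
      mean := by
        have hint : Integrable (fun ω => scoreVec τ f (m n) (U ω) (W ω)) P :=
          (hXL n).integrable (by norm_num)
        rw [hQ, integral_map (hXm n).aemeasurable (by fun_prop)]
        ext j
        rw [integral_scoreVec_apply hint, integral_mul_comp_eq_zero hW hUW
          (hU4.integrable (by norm_num)) (hf j) ((hUf j).integrable (by norm_num)), mul_zero]
        rfl }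
  have hfrob : ∀ n, √(covNormSq (Q n)) = frobSigma P U W τ f (m n) := fun n =>
    sqrt_covNormSq_map_scoreVec hf hW hU (hXL n)
  have htrace : ∀ n, ∫ x, ‖x‖ ^ 2 ∂(Q n) = traceSigma P U W τ f (m n) := fun n =>
    integral_norm_sq_map_scoreVec hf hW hU hA4 fun j => (memLp_two_of_four (hUf j)).integrable_sq
  set ρ : ℕ → ℝ := fun n => ∑ j ∈ Finset.range (m n), τ j with hρdef
  have hρ0 : ∀ n, 0 ≤ ρ n := fun n => Finset.sum_nonneg fun j _ => (hA4.pos j).le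
  -- K₁ controls the fourth moment of the noise vectors and K₂ the second moment of the alternative
  -- vectors; their sum serves as the single constant K.
  set K₁ : ℝ := √(σ ^ 4 * ηp * ηf)
  set K₂ : ℝ := √(∫ ω, δ (Z ω) ^ 4 ∂P) * √(ηp * ηf)
  have hK₁ : 0 ≤ K₁ := Real.sqrt_nonneg _
  have hK₂ : 0 ≤ K₂ := by positivity
  have hL : ∀ n, fourthMoment (Q n) ≤ (K₁ + K₂) ^ 2 * ρ n ^ 2 := fun n => by
    rw [fourthMoment, hQ, integral_map (hXm n).aemeasurable (by fun_prop)]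
    refine (hdom.integral_norm_scoreVec_pow_four_le hb hW hU hf hηf hf4 hA4 (m n)).trans ?_
    refine mul_le_mul_of_nonneg_right ?_ (sq_nonneg _)
    rw [← Real.sq_sqrt (mul_nonneg hb hηf)]
    exact pow_le_pow_left₀ hK₁ (le_add_of_nonneg_right hK₂) 2
  have hm : Tendsto m atTop atTop := tendsto_atTop_of_tendsto_comp frobSigma_mono hm₁
  set d : ∀ n, EuclideanSpace ℝ (Fin (m n)) := fun n =>
    ∫ ω, scoreVec τ f (m n) (δ (Z ω)) (W ω) ∂P with hd
  have hdn : ∀ n, ‖d n‖ ^ 2 = ∑ j ∈ Finset.range (m n), deltaCoef P Z W τ f δ j ^ 2 := fun n => by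
    rw [EuclideanSpace.norm_sq_eq,
      ← Fin.sum_univ_eq_sum_range (fun j => deltaCoef P Z W τ f δ j ^ 2)]
    refine Finset.sum_congr rfl fun j _ => ?_
    rw [hd, integral_scoreVec_apply ((hGL n).integrable one_le_two), Real.norm_eq_abs, sq_abs,
      deltaCoef]
  have hD : Tendsto (fun n => ‖d n‖ ^ 2) atTop (𝓝 (∑' j, deltaCoef P Z W τ f δ j ^ 2)) := by
    simp_rw [hdn]
    exact hsum.hasSum.tendsto_sum_nat.comp hm
  -- The dimension-free covariance bound is C = η_p + σ⁴η_p.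
  have hmain := tendstoInDistribution_normSq (P := P) hsample (add_nonneg ha hb)
    (fun n x => by
      have := (hsample n).isProbabilityMeasure
      rw [cov_self (hsample n).memLp_id, hQ, integral_map (hXm n).aemeasurable (by fun_prop)]
      exact hdom.integral_inner_scoreVec_sq_le ha hb hW hU hf hbasis hA4 x)
    (by simpa only [hfrob] using hm₁)
    (G := fun n i ω => scoreVec τ f (m n) (δ (ζ i ω).1) (ζ i ω).2.1)
    (fun n i => (hφG n).comp (hζm i)) (fun n => hζi.comp _ fun _ => hφG n)
    (fun n i => ((hζl i).comp (hφG n)).memLp_iff.2 (hGL n)) (d := d)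
    (fun n i => ((hζl i).comp (hφG n)).integral_eq) hρ0
    (tendsto_sq_div_of_cube_isLittleO hρ0 hm₂) hL (add_nonneg hK₁ hK₂)
    (fun n i => by
      refine (((hζl i).comp (hφG n)).norm.sq.integral_eq).trans_le ?_
      refine (hdom.integral_norm_scoreVec_sq_le ha hW hf hηf hf4 hδ4 hA4 (m n)).trans ?_
      exact mul_le_mul_of_nonneg_right (le_add_of_nonneg_left hK₁) (hρ0 n))
    hD
  -- For each n the statistic agrees almost surely with the one built from measurable versions; only
  -- the n observations with i < n enter.
  refine hmain.congr (fun n => ?_) .rfl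
  have hall : ∀ᵐ ω ∂P, ∀ i < n, (Zs i ω, Ws i ω, Us i ω) = ζ i ω ∧ Y n i ω = φ₀ (Zs i ω)
      + √(frobSigma P U W τ f (m n)) / √n * δ (Zs i ω) + Us i ω := by
    refine ae_all_iff.2 fun i => ?_
    by_cases hi : i < n
    · filter_upwards [hζe i, hY n i hi] with ω h1 h2 _ using ⟨h1, h2⟩
    · exact .of_forall fun ω h => absurd h hi
  filter_upwards [hall] with ω hω
  rw [htrace, hfrob, testStat]
  simp_rw [scoreVec_add_smul]
  rw [norm_partialSum_scoreVec hA4]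
  congr 3
  refine Finset.sum_congr rfl fun j _ => ?_
  congr 4
  refine Finset.sum_congr rfl fun i hi => ?_
  obtain ⟨h1, h2⟩ := hω i (Finset.mem_range.1 hi)
  rw [h2, ← h1]
  ring
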